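/- Let $0<\beta<1$ and $1<\alpha<2$. Let $E_\beta(z)=\sum_{n\ge 0} z^n/\Gamma(\beta n+1)$ be the Mittag-Leffler function. A generalized grey Brownian motion $B_{\beta,\alpha}=(B_{\beta,\alpha}(t))_{t\ge 0}$ is a real-valued process with almost surely continuous paths and $B_{\beta,\alpha}(0)=0$ almost surely, such that for all $0\le t_1<\dots<t_n$ and $\theta\in\mathbb{R}^n$ $$\mathbb{E}\exp\Big(i\sum_{k=1}^n\theta_k B_{\beta,\alpha}(t_k)\Big)=E_\beta\big(-\tfrac12\theta^{\top}\Sigma_\alpha\theta\big),\qquad \Sigma_\alpha=\Big(\tfrac12\big(t_k^\alpha+t_j^\alpha-|t_k-t_j|^\alpha\big)\Big)_{k,j=1}^n .$$ Let $S_\beta=(S_\beta(s))_{s\ge0}$ be a $\beta$-stable subordinator, with $\mathbb{E}e^{-\theta S_\beta(s)}=e^{-s\theta^\beta}$ for $\theta>0$, let $U_\beta(t)=\inf\{s\ge 0: S_\beta(s)>t\}$ be its inverse, let $W$ be a standard Brownian motion independent of $S_\beta$, and let $X_{\beta,\alpha}(t)=W\big(U_\beta(t^{\alpha/\beta})\big)$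 for $t\ge0$. Let $C([0,1],\mathbb{R})$ be the space of continuous functions $w:[0,1]\to\mathbb{R}$ with $w(0)=0$, with the $\sigma$-algebra generated by the cylinder sets, and let $P_{B_{\beta,\alpha}}$ and $P_{X_{\beta,\alpha}}$ be the probability measures induced on it by the two processes restricted to $[0,1]$. For $p>0$ let $v_p(w)=\sup\sum_{k=1}^n|w(t_k)-w(t_{k-1})|^p$, the supremum being over all partitions $0=t_0<t_1<\dots<t_n=1$, and let $\upsilon(w)=\inf\{p>0: v_p(w)<\infty\}$ (with $\inf\emptyset=+\infty$) be the $p$-variation index of $w$. Then: 1. $P_{B_{\beta,\alpha}}$ and $P_{X_{\beta,\alpha}}$ are mutually singular. 2. For every $t\ge 0$, the random variables $B_{\beta,\alpha}(t)$ and $X_{\beta,\alpha}(t)$ have the same distribution. 3. The sets $\{w:\upsilon(w)=2/\alpha\}$ and $\{w:\upsilon(w)=2\}$ (which are disjoint, since $2/\alpha<2$) are measurable, and $P_{B_{\beta,\alpha}}(\{w:\upsilon(w)=2/\alpha\})=1$ and $P_{X_{\beta,\alpha}}(\{w:\upsilon(w)=2\})=1$. -/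

import Mathlib

open MeasureTheory ProbabilityTheory Set
open scoped NNReal ENNReal

noncomputable section

/-! ### The path space `C([0,1], ℝ)` of continuous functions vanishing at `0` -/

/-- Continuous functions `w : [0,1] → ℝ` with `w 0 = 0`. -/
structure PathSpace : Type where
  toFun : unitInterval → ℝ
  continuous_toFun : Continuous toFun
  map_zero : toFun 0 = 0

instance PathSpace.instCoeFun : CoeFun PathSpace (fun _ => unitInterval → ℝ) :=
  ⟨PathSpace.toFun⟩

/-- The σ-algebra generated by the cylinder sets. -/
instance PathSpace.instMeasurableSpace : MeasurableSpace PathSpace :=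
  ⨆ t : unitInterval, MeasurableSpace.comap (fun w : PathSpace => w t) inferInstance

/-- The path that is identically zero. -/
def PathSpace.zero : PathSpace :=
  ⟨fun _ => 0, continuous_const, rfl⟩

open Classical in
/-- The path on `[0,1]` of a process `Y` at the sample point `ω`. Outside the event that this path
is continuous and starts from zero (a null event for the processes considered here) the value is
set to the zero path. -/
def toPath {Ω : Type*} (Y : ℝ≥0 → Ω → ℝ) (ω : Ω) : PathSpace :=
  if h : Continuous (fun t : unitInterval => Y (unitInterval.toNNReal t) ω) ∧
      Y (unitInterval.toNNReal 0) ω = 0 then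
    ⟨fun t => Y (unitInterval.toNNReal t) ω, h.1, h.2⟩
  else PathSpace.zero

/-- The probability measure that a process `Y` with almost surely continuous paths starting from
zero induces on the path space over `[0,1]`. -/
def pathLaw {Ω : Type*} [MeasurableSpace Ω] (Y : ℝ≥0 → Ω → ℝ) (P : Measure Ω) :
    Measure PathSpace :=
  P.map (toPath Y)

/-! ### `p`-variation and the `p`-variation index -/

/-- The `p`-variation of `f` over `[0,1]`: the supremum of `∑ |f (t_{k+1}) - f (t_k)| ^ p` over all
partitions `0 = t_0 < t_1 < ... < t_n = 1`. -/
def pVariation (p : ℝ) (f : unitInterval → ℝ) : ℝ≥0∞ :=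
  ⨆ (n : ℕ) (t : Fin (n + 1) → unitInterval)
    (_ : StrictMono t ∧ t 0 = 0 ∧ t (Fin.last n) = 1),
    ∑ k : Fin n, ENNReal.ofReal (|f (t k.succ) - f (t k.castSucc)| ^ p)

/-- The `p`-variation index of `f`: the infimum of all `p > 0` for which the `p`-variation is
finite, and `∞` if there is no such `p`. -/
def pVariationIndex (f : unitInterval → ℝ) : ℝ≥0∞ :=
  ⨅ (p : ℝ) (_ : 0 < p ∧ pVariation p f < ∞), ENNReal.ofReal p

/-- The set of all paths whose `p`-variation index is `q`. -/
def indexEvent (q : ℝ) : Set PathSpace :=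
  {w | pVariationIndex w = ENNReal.ofReal q}

/-! ### Generalized grey Brownian motion -/

/-- The Mittag-Leffler function `E_β(z) = ∑ z ^ n / Γ(β n + 1)`. -/
def mittagLeffler (β : ℝ) (z : ℂ) : ℂ :=
  ∑' n : ℕ, z ^ n / Complex.Gamma (β * n + 1)

/-- The covariance `(t ^ α + s ^ α - |t - s| ^ α) / 2` of fractional Brownian motion with Hurst
parameter `α / 2`. -/
def fbmCov (α : ℝ) (t s : ℝ≥0) : ℝ :=
  ((t : ℝ) ^ α + (s : ℝ) ^ α - |(t : ℝ) - (s : ℝ)| ^ α) / 2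

/-- `B` is a generalized grey Brownian motion with parameters `β` and `α`. -/
structure IsGGBm {Ω : Type*} [MeasurableSpace Ω] (β α : ℝ) (B : ℝ≥0 → Ω → ℝ)
    (P : Measure Ω) : Prop where
  measurable : ∀ t, Measurable (B t)
  continuous_paths : ∀ᵐ ω ∂P, Continuous fun t => B t ω
  zero : ∀ᵐ ω ∂P, B 0 ω = 0
  charFun_eq : ∀ (n : ℕ) (t : Fin n → ℝ≥0), StrictMono t → ∀ θ : Fin n → ℝ,
    ∫ ω, Complex.exp (Complex.I * ((∑ k, θ k * B (t k) ω : ℝ) : ℂ)) ∂P =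
      mittagLeffler β ((-(1 / 2) * ∑ k, ∑ j, θ k * fbmCov α (t k) (t j) * θ j : ℝ) : ℂ)

/-! ### Time-changed Brownian motion -/

/-- `S` is a `β`-stable subordinator: a Lévy process with nondecreasing right-continuous paths and
Laplace transform `E[exp(-θ S_t)] = exp(-t θ ^ β)`. (Its paths are then almost surely strictly
increasing.) -/
structure IsStableSubordinator {Ω : Type*} [MeasurableSpace Ω] (β : ℝ) (S : ℝ≥0 → Ω → ℝ)
    (P : Measure Ω) : Prop where
  measurable : ∀ t, Measurable (S t)
  zero : ∀ᵐ ω ∂P, S 0 ω = 0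
  monotone_paths : ∀ᵐ ω ∂P, Monotone fun t => S t ω
  rightContinuous_paths : ∀ᵐ ω ∂P, ∀ t, ContinuousWithinAt (fun s => S s ω) (Ici t) t
  indep_increments : HasIndepIncrements S P
  stationary_increments : ∀ s t : ℝ≥0, IdentDistrib (fun ω => S (s + t) ω - S s ω) (S t) P P
  laplace : ∀ (t : ℝ≥0) (θ : ℝ), 0 < θ →
    ∫ ω, Real.exp (-θ * S t ω) ∂P = Real.exp (-(t : ℝ) * θ ^ β)

/-- The inverse process `U(t) = inf {s ≥ 0 | S(s) > t}`. -/
def inverseProcess {Ω : Type*} (S : ℝ≥0 → Ω → ℝ) (t : ℝ≥0) (ω : Ω) : ℝ≥0 :=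
  sInf {s : ℝ≥0 | (t : ℝ) < S s ω}

/-- The time-changed process `X(t) = W(U(t ^ (α / β)))`, where `U` is the inverse of `S`. -/
def timeChanged {Ω : Type*} (β α : ℝ) (W S : ℝ≥0 → Ω → ℝ) (t : ℝ≥0) (ω : Ω) : ℝ :=
  W (inverseProcess S (t ^ (α / β)) ω) ω

end

/-! The two processes agree at single times, but the roughness of their paths differs, and the
variation index detects this.

Call increments scaling if the one over [s, t] is distributed as (t - s)^H times a fixed variable
(`HasScalingIncrements`). For B this holds with H = α/2, by the two-point characteristic function;
for W with H = 1/2. If moreover paths are continuous, the fixed variable has finite even moments and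
no atom at 0, then the index is 1/H. Above 1/H: Kolmogorov–Chentsov gives γ-Hölder paths for all γ <
H (`HasScalingIncrements.ae_holder`). Below 1/H: finite p-variation would force increments of order
h^(1/p) at almost every time, by Lebesgue differentiation of the variation function, whereas scaling
excludes this rate at each fixed time; Fubini makes the two incompatible
(`HasScalingIncrements.ae_seqVariation_eq_top`). Independence of increments is not needed.

X is W run along a continuous nondecreasing clock φ with φ(0) = 0 < φ(1), so X inherits the index 2
of W.

For the one-dimensional laws, the events {U(t) ≥ s} and {S(s) ≤ t} essentially coincide, so
self-similarity gives U(t) the moments of (t/S(1))^β. These are n! t^(nβ)/Γ(nβ+1)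
(`lintegral_inverseProcess_pow`), whence E exp(zU(t)) is a Mittag-Leffler value. Conditioning W(U)
on U then yields the characteristic function of B(t). The same identity supplies the moments of B(1)
and its lack of an atom. -/

noncomputable section

open Filter Topology

/-! ### Variation along monotone sequences -/

/-- The `p`-variation of `f` on `[0, T]`, computed over monotone finite sequences. -/
def seqVariation (p : ℝ) (f : ℝ≥0 → ℝ) (T : ℝ≥0) : ℝ≥0∞ :=
  ⨆ (n : ℕ) (u : ℕ → ℝ≥0) (_ : Monotone u ∧ ∀ i, u i ≤ T),
    ∑ i ∈ Finset.range n, ENNReal.ofReal (|f (u (i + 1)) - f (u i)| ^ p)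

theorem sum_le_seqVariation (p : ℝ) (f : ℝ≥0 → ℝ) {T : ℝ≥0} (n : ℕ) {u : ℕ → ℝ≥0}
    (hu : Monotone u) (huT : ∀ i, u i ≤ T) :
    ∑ i ∈ Finset.range n, ENNReal.ofReal (|f (u (i + 1)) - f (u i)| ^ p) ≤ seqVariation p f T :=
  le_iSup_of_le n (le_iSup_of_le u (le_iSup_of_le ⟨hu, huT⟩ le_rfl))

theorem seqVariation_le_iff {p : ℝ} {f : ℝ≥0 → ℝ} {T : ℝ≥0} {c : ℝ≥0∞} :
    seqVariation p f T ≤ c ↔ ∀ (n : ℕ) (u : ℕ → ℝ≥0), Monotone u → (∀ i, u i ≤ T) →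
      ∑ i ∈ Finset.range n, ENNReal.ofReal (|f (u (i + 1)) - f (u i)| ^ p) ≤ c := by
  simp only [seqVariation, iSup_le_iff, and_imp]

theorem seqVariation_mono (p : ℝ) (f : ℝ≥0 → ℝ) : Monotone (seqVariation p f) := fun _ _ h =>
  seqVariation_le_iff.2 fun n _ hu huT =>
    sum_le_seqVariation p f n hu fun i => (huT i).trans h

/-- Any sequence in [0, s] can be prolonged by the points s and t; the term joining its last point
to s is discarded. -/
theorem seqVariation_add_le (p : ℝ) (f : ℝ≥0 → ℝ) {s t : ℝ≥0} (hst : s ≤ t) :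
    seqVariation p f s + ENNReal.ofReal (|f t - f s| ^ p) ≤ seqVariation p f t := by
  rw [seqVariation, ENNReal.iSup_add]
  refine iSup_le fun n => ?_
  rw [ENNReal.biSup_add' (p := fun u : ℕ → ℝ≥0 => Monotone u ∧ ∀ i, u i ≤ s)
    ⟨fun _ => s, monotone_const, fun _ => le_rfl⟩]
  · refine iSup₂_le fun u ⟨hu, hus⟩ => ?_
    let v : ℕ → ℝ≥0 := fun i => if i ≤ n then u i else if i = n + 1 then s else t
    have hv : Monotone v := by
      refine monotone_nat_of_le_succ fun i => ?_
      simp only [v]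
      rcases lt_trichotomy i n with h | h | h
      · rw [if_pos h.le, if_pos (by omega)]; exact hu (Nat.le_succ i)
      · subst h
        simp [hus]
      · rw [if_neg h.not_ge, if_neg (h.trans (Nat.lt_succ_self i)).not_ge,
          if_neg (show ¬ i + 1 = n + 1 by omega)]
        split_ifs
        exacts [hst, le_rfl]
    have hvt : ∀ i, v i ≤ t := by
      intro i
      simp only [v]
      split_ifs
      exacts [(hus i).trans hst, hst, le_rfl]
    refine le_trans ?_ (sum_le_seqVariation p f (n + 2) hv hvt)
    rw [Finset.sum_range_succ, Finset.sum_range_succ]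
    refine add_le_add (le_trans (le_of_eq ?_) le_self_add) (le_of_eq ?_)
    · refine Finset.sum_congr rfl fun i hi => ?_
      have := Finset.mem_range.1 hi
      simp only [v]
      rw [if_pos (by omega), if_pos (by omega)]
    · simp [v]

/-- The variation function V is monotone, hence differentiable almost everywhere, and |f(x+h) -
f(x)|^p ≤ V(x+h) - V(x) = O(h) there. Steps h = 1/(n+1) and natural C keep the conclusion a
countable condition. -/
theorem ae_increment_le_of_seqVariation_lt_top {p : ℝ} (hp : 0 < p) {f : ℝ≥0 → ℝ} {T : ℝ≥0}
    (h : seqVariation p f T < ∞) :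
    ∀ᵐ x : ℝ, x ∈ Ioo (0 : ℝ) T → ∃ C : ℕ, ∀ᶠ n : ℕ in atTop,
      |f (x.toNNReal + (1 / (n + 1 : ℝ≥0))) - f x.toNNReal| ≤ C * (1 / (n + 1 : ℝ)) ^ (1 / p) := by
  have hfin : ∀ s ≤ T, seqVariation p f s ≠ ∞ := fun s hs =>
    ((seqVariation_mono p f hs).trans_lt h).ne
  -- Truncating at T makes V finite and monotone on all of ℝ.
  let V : ℝ → ℝ := fun x => (seqVariation p f (min x.toNNReal T)).toReal
  have hV : Monotone V := fun x y hxy => ENNReal.toReal_mono (hfin _ (min_le_right _ _))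
    (seqVariation_mono p f (min_le_min_right _ (Real.toNNReal_le_toNNReal hxy)))
  filter_upwards [hV.ae_differentiableAt] with x hx hxT
  have hlim : Tendsto (fun n : ℕ => (1 / (n + 1 : ℝ))) atTop (𝓝 0) :=
    tendsto_one_div_add_atTop_nhds_zero_nat
  have hlim' : Tendsto (fun n : ℕ => (1 / (n + 1 : ℝ))) atTop (𝓝[≠] 0) :=
    tendsto_nhdsWithin_iff.2 ⟨hlim, Eventually.of_forall fun n => by
      simp only [mem_compl_iff, mem_singleton_iff]; positivity⟩
  have hd := (hasDerivAt_iff_tendsto_slope_zero.1 hx.hasDerivAt).comp hlim'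
  obtain ⟨D, hD⟩ := exists_nat_gt (max (deriv V x) 0)
  have hD0 : (0 : ℝ) < D := (le_max_right _ _).trans_lt hD
  have hev := hd.eventually (gt_mem_nhds ((le_max_left _ _).trans_lt hD))
  have hevT : ∀ᶠ n : ℕ in atTop, x + 1 / (n + 1 : ℝ) < T := by
    have : Tendsto (fun n : ℕ => x + 1 / (n + 1 : ℝ)) atTop (𝓝 (x + 0)) := hlim.const_add x
    rw [add_zero] at this
    exact this.eventually (gt_mem_nhds hxT.2)
  obtain ⟨C, hC⟩ := exists_nat_ge ((D : ℝ) ^ (1 / p))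
  refine ⟨C, ?_⟩
  filter_upwards [hev, hevT] with n hn hnT
  have hh : (0 : ℝ) < 1 / (n + 1 : ℝ) := by positivity
  simp only [Function.comp, smul_eq_mul] at hn
  have hinc : V (x + 1 / (n + 1)) - V x ≤ D * (1 / (n + 1 : ℝ)) := by
    rw [inv_mul_lt_iff₀ hh] at hn
    linarith
  have e1 : (x + 1 / (n + 1 : ℝ)).toNNReal = x.toNNReal + (1 / (n + 1 : ℝ≥0)) := by
    rw [Real.toNNReal_add hxT.1.le hh.le]
    congr 1
    rw [Real.toNNReal_of_nonneg hh.le]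
    ext; simp
  have l1 : x.toNNReal ≤ T := Real.toNNReal_le_iff_le_coe.2 hxT.2.le
  have l2 : x.toNNReal + (1 / (n + 1 : ℝ≥0)) ≤ T := by
    rw [← e1]; exact Real.toNNReal_le_iff_le_coe.2 hnT.le
  have hpow : |f (x.toNNReal + (1 / (n + 1 : ℝ≥0))) - f x.toNNReal| ^ p ≤
      D * (1 / (n + 1 : ℝ)) := by
    refine le_trans ?_ hinc
    have := seqVariation_add_le p f (s := x.toNNReal) (t := x.toNNReal + (1 / (n + 1 : ℝ≥0)))
      le_self_add
    have h2 := ENNReal.toReal_mono (hfin _ l2) this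
    rw [ENNReal.toReal_add (hfin _ l1) ENNReal.ofReal_ne_top,
      ENNReal.toReal_ofReal (by positivity)] at h2
    simp only [V, e1, min_eq_left l1, min_eq_left l2]
    linarith
  calc |f (x.toNNReal + (1 / (n + 1 : ℝ≥0))) - f x.toNNReal|
      = (|f (x.toNNReal + (1 / (n + 1 : ℝ≥0))) - f x.toNNReal| ^ p) ^ (1 / p) := by
        rw [← Real.rpow_mul (abs_nonneg _), mul_one_div_cancel hp.ne', Real.rpow_one]
    _ ≤ (D * (1 / (n + 1 : ℝ))) ^ (1 / p) := by gcongr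
    _ = (D : ℝ) ^ (1 / p) * (1 / (n + 1 : ℝ)) ^ (1 / p) := Real.mul_rpow hD0.le hh.le
    _ ≤ _ := by gcongr

/-! ### Comparison with the p-variation over partitions, and the index -/

/-- Partitions must be strictly increasing. Mixing the sequence with ε times the uniform partition
makes it strict and keeps the endpoints; continuity of w allows ε → 0. -/
theorem sum_le_pVariation {p : ℝ} (hp : 0 < p) {w : unitInterval → ℝ} (hw : Continuous w)
    {n : ℕ} (hn : 0 < n) {a : ℕ → unitInterval} (ha : Monotone a) (h0 : a 0 = 0)
    (h1 : a n = 1) :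
    ∑ i ∈ Finset.range n, ENNReal.ofReal (|w (a (i + 1)) - w (a i)| ^ p) ≤ pVariation p w := by
  let v : ℝ → ℕ → ℝ := fun ε i => (1 - ε) * a i + ε * (i / n)
  have hn' : (0 : ℝ) < n := by exact_mod_cast hn
  let P : ℝ → ℕ → unitInterval := fun ε i => projIcc 0 1 zero_le_one (v ε i)
  have hPc : ∀ i, Continuous fun ε => P ε i := fun i =>
    continuous_projIcc.comp (by fun_prop)
  have hP0 : ∀ i, P 0 i = a i := fun i => by simp [P, v]
  have hlim : Tendsto (fun ε => ∑ i ∈ Finset.range n,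
      ENNReal.ofReal (|w (P ε (i + 1)) - w (P ε i)| ^ p)) (𝓝[>] 0)
      (𝓝 (∑ i ∈ Finset.range n, ENNReal.ofReal (|w (a (i + 1)) - w (a i)| ^ p))) := by
    have hc : Continuous (fun ε => ∑ i ∈ Finset.range n,
      ENNReal.ofReal (|w (P ε (i + 1)) - w (P ε i)| ^ p)) := by
      refine continuous_finsetSum _ fun i _ => ENNReal.continuous_ofReal.comp ?_
      exact (((hw.comp (hPc _)).sub (hw.comp (hPc _))).abs).rpow_const fun _ => Or.inr hp.le
    have := (hc.tendsto 0).mono_left (nhdsWithin_le_nhds (s := Ioi 0))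
    simpa only [hP0] using this
  refine le_of_tendsto hlim ?_
  filter_upwards [Ioo_mem_nhdsGT (zero_lt_one' ℝ)] with ε hε
  have hvmem : ∀ i ≤ n, v ε i ∈ Icc (0 : ℝ) 1 := fun i hi => by
    have := (a i).2
    have h2 : (i : ℝ) / n ≤ 1 := (div_le_one hn').2 (by exact_mod_cast hi)
    have h3 : (0 : ℝ) ≤ i / n := by positivity
    refine ⟨?_, ?_⟩
    · have := mul_nonneg (sub_nonneg.2 hε.2.le) this.1
      have := mul_nonneg hε.1.le h3
      simp only [v]; linarith
    · have := mul_le_mul_of_nonneg_left this.2 (sub_nonneg.2 hε.2.le)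
      have := mul_le_mul_of_nonneg_left h2 hε.1.le
      simp only [v]; linarith
  have hcoe : ∀ i ≤ n, ((P ε i : unitInterval) : ℝ) = v ε i := fun i hi => by
    simp only [P]; rw [projIcc_of_mem zero_le_one (hvmem i hi)]
  rw [Finset.sum_range]
  refine le_iSup_of_le n (le_iSup_of_le (fun k : Fin (n + 1) => P ε k)
    (le_iSup_of_le ⟨?_, ?_, ?_⟩ ?_))
  · intro i j hij
    rw [← Subtype.coe_lt_coe, hcoe _ (Nat.lt_succ_iff.1 i.2), hcoe _ (Nat.lt_succ_iff.1 j.2)]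
    have h2 : ((a i : unitInterval) : ℝ) ≤ a j := ha (le_of_lt hij)
    have h3 : ((i : ℕ) : ℝ) / n < (j : ℕ) / n := by
      have : ((i : ℕ) : ℝ) < (j : ℕ) := by exact_mod_cast hij
      gcongr
    have := mul_le_mul_of_nonneg_left h2 (sub_nonneg.2 hε.2.le)
    have := mul_lt_mul_of_pos_left h3 hε.1
    simp only [v]; linarith
  · ext; simp only; rw [Fin.val_zero, hcoe _ (Nat.zero_le n)]; simp [v, h0]
  · ext; simp only; rw [Fin.val_last, hcoe _ le_rfl]; simp [v, h1, hn'.ne']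
  · simp

theorem seqVariation_one_le_pVariation {p : ℝ} (hp : 0 < p) {f : ℝ≥0 → ℝ} (hf : Continuous f) :
    seqVariation p f 1 ≤ pVariation p fun t => f (unitInterval.toNNReal t) := by
  refine seqVariation_le_iff.2 fun n u hu hu1 => ?_
  -- The points of u are shifted by one index to make room for 0 in front; 1 is appended at index n
  -- + 2.
  let a : ℕ → unitInterval := fun i =>
    if i = 0 then 0 else if i ≤ n + 1 then ⟨u (i - 1), (u _).2, by exact_mod_cast hu1 _⟩ else 1
  have ha : Monotone a := by
    refine monotone_nat_of_le_succ fun i => ?_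
    simp only [a]
    by_cases h0 : i = 0
    · rw [if_pos h0]; exact unitInterval.nonneg'
    rw [if_neg h0, if_neg (Nat.succ_ne_zero i)]
    by_cases h1 : i + 1 ≤ n + 1
    · rw [if_pos h1, if_pos (Nat.le_of_succ_le h1)]
      exact Subtype.mk_le_mk.2 (by exact_mod_cast hu (Nat.sub_le_sub_right (Nat.le_succ i) 1))
    · rw [if_neg h1]; exact unitInterval.le_one'
  have hw : Continuous fun t : unitInterval => f (unitInterval.toNNReal t) :=
    hf.comp unitInterval.toNNReal_continuous
  refine le_trans ?_ (sum_le_pVariation hp hw (n := n + 2) (by omega) ha (by simp [a])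
    (by simp [a]))
  rw [Finset.sum_range_succ, Finset.sum_range_succ']
  refine le_trans (le_trans (le_of_eq ?_) le_self_add) le_self_add
  refine Finset.sum_congr rfl fun i hi => ?_
  have hi' := Finset.mem_range.1 hi
  have e : ∀ i ≤ n, unitInterval.toNNReal (a (i + 1)) = u i := fun i hi => by
    simp only [a]
    rw [if_neg (by omega), if_pos (by omega)]
    rfl
  rw [e (i + 1) (by omega), e i (by omega)]

/-- By the intermediate value theorem φ has a section on [0, T], which is monotone because φ
reflects the strict order. This transfers roughness of W to the time-changed path. -/
theorem seqVariation_le_comp (p : ℝ) (f : ℝ≥0 → ℝ) {φ : ℝ≥0 → ℝ≥0} (hφ : Monotone φ)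
    (hφc : Continuous φ) (h0 : φ 0 = 0) {T : ℝ≥0} (hT : T ≤ φ 1) :
    seqVariation p f T ≤ seqVariation p (fun t => f (φ t)) 1 := by
  refine seqVariation_le_iff.2 fun n u hu huT => ?_
  have hex : ∀ y ≤ T, ∃ x ≤ (1 : ℝ≥0), φ x = y := fun y hy => by
    obtain ⟨x, hx, rfl⟩ := intermediate_value_Icc (zero_le (a := (1 : ℝ≥0))) hφc.continuousOn
      (show y ∈ Icc (φ 0) (φ 1) from ⟨by simp [h0], hy.trans hT⟩)
    exact ⟨x, hx.2, rfl⟩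
  choose! r hr1 hr using hex
  have hmono : Monotone fun i => r (u i) := by
    intro i j hij
    rcases (hu hij).eq_or_lt with h | h
    · simp [h]
    · refine (hφ.reflect_lt ?_).le
      rwa [hr _ (huT i), hr _ (huT j)]
  have := sum_le_seqVariation p (fun t => f (φ t)) n hmono fun i => hr1 _ (huT i)
  simpa only [hr _ (huT _)] using this

theorem Fin.sum_succ_sub_castSucc {M : Type*} [AddCommGroup M] :
    ∀ {n : ℕ} (g : Fin (n + 1) → M), ∑ k : Fin n, (g k.succ - g k.castSucc) = g (Fin.last n) - g 0
  | 0, g => by simp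
  | n + 1, g => by
    rw [Fin.sum_univ_castSucc]
    have := Fin.sum_succ_sub_castSucc fun k : Fin (n + 1) => g k.castSucc
    simp only [← Fin.succ_castSucc] at this ⊢
    simp only [this]
    simp

/-- The p-th powers of the increments are dominated by a telescoping sum. A general g covers both
ordinary time and the random clock. -/
theorem pVariation_lt_top_of_le_rpow {p : ℝ} (hp : 0 < p) {w : unitInterval → ℝ}
    {g : unitInterval → ℝ} (hg : Monotone g) {C : ℝ}
    (h : ∀ s t, s ≤ t → |w t - w s| ≤ C * (g t - g s) ^ (1 / p)) : pVariation p w < ∞ := by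
  have hC : ∀ s t, s ≤ t → |w t - w s| ≤ |C| * (g t - g s) ^ (1 / p) := fun s t hst =>
    (h s t hst).trans (mul_le_mul_of_nonneg_right (le_abs_self C)
      (Real.rpow_nonneg (sub_nonneg.2 (hg hst)) _))
  refine lt_of_le_of_lt (b := ENNReal.ofReal (|C| ^ p * (g 1 - g 0))) ?_ ENNReal.ofReal_lt_top
  refine iSup_le fun n => iSup_le fun t => iSup_le fun ⟨hm, h0, h1⟩ => ?_
  rw [← ENNReal.ofReal_sum_of_nonneg fun k _ => by positivity]
  refine ENNReal.ofReal_le_ofReal ?_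
  rw [← h0, ← h1, ← Fin.sum_succ_sub_castSucc fun k => g (t k), Finset.mul_sum]
  refine Finset.sum_le_sum fun k _ => ?_
  have hk : t k.castSucc ≤ t k.succ := hm.monotone (Fin.castSucc_lt_succ).le
  have hd : 0 ≤ g (t k.succ) - g (t k.castSucc) := sub_nonneg.2 (hg hk)
  calc _ ≤ (|C| * (g (t k.succ) - g (t k.castSucc)) ^ (1 / p)) ^ p := by
        gcongr; exact hC _ _ hk
    _ = _ := by
        rw [Real.mul_rpow (abs_nonneg C) (Real.rpow_nonneg hd _), ← Real.rpow_mul hd,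
          one_div_mul_cancel hp.ne', Real.rpow_one]

/-- If |w| ≤ M, each increment d satisfies d^r ≤ (2M)^(r-p) d^p. -/
theorem pVariation_lt_top_mono {p r : ℝ} (hp : 0 < p) (hpr : p ≤ r) {w : unitInterval → ℝ}
    (hw : Continuous w) (h : pVariation p w < ∞) : pVariation r w < ∞ := by
  obtain ⟨M, hM⟩ := (isCompact_univ.image hw).isBounded.exists_norm_le
  have hM' : ∀ x, |w x| ≤ M := fun x => hM _ (mem_image_of_mem w (mem_univ x))
  have hM0 : 0 ≤ M := (abs_nonneg _).trans (hM' 0)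
  have key : pVariation r w ≤ ENNReal.ofReal ((2 * M) ^ (r - p)) * pVariation p w := by
    refine iSup_le fun n => iSup_le fun t => iSup_le fun ht => ?_
    have hle : ∑ k : Fin n, ENNReal.ofReal (|w (t k.succ) - w (t k.castSucc)| ^ p) ≤
        pVariation p w := le_iSup_of_le n (le_iSup_of_le t (le_iSup_of_le ht le_rfl))
    refine le_trans ?_ (mul_le_mul_right hle _)
    rw [Finset.mul_sum]
    refine Finset.sum_le_sum fun k _ => ?_
    rw [← ENNReal.ofReal_mul (by positivity)]
    refine ENNReal.ofReal_le_ofReal ?_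
    set d := |w (t k.succ) - w (t k.castSucc)|
    have hd : d ≤ 2 * M := (abs_sub _ _).trans (by linarith [hM' (t k.succ), hM' (t k.castSucc)])
    have hd0 : 0 ≤ d := abs_nonneg _
    calc d ^ r = d ^ (r - p) * d ^ p := by
          rcases hd0.eq_or_lt with h | h
          · rw [← h, Real.zero_rpow (hp.trans_le hpr).ne', Real.zero_rpow hp.ne', mul_zero]
          · rw [← Real.rpow_add h]; simp
      _ ≤ _ := by gcongr
  exact key.trans_lt (ENNReal.mul_lt_top ENNReal.ofReal_lt_top h)

/-- Only rational exponents are tested, so that almost sure statements can be intersected over p. -/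
theorem pVariationIndex_eq_of_forall {q : ℝ} (hq : 0 < q) {w : unitInterval → ℝ}
    (hlt : ∀ p : ℚ, q < p → pVariation p w < ∞)
    (hgt : ∀ p : ℚ, 0 < p → (p : ℝ) < q → pVariation p w = ∞) (hw : Continuous w) :
    pVariationIndex w = ENNReal.ofReal q := by
  refine le_antisymm ?_ (le_iInf fun p => le_iInf fun ⟨hp, hpw⟩ => ENNReal.ofReal_le_ofReal ?_)
  · refine ENNReal.le_of_forall_pos_le_add fun ε hε _ => ?_
    obtain ⟨r, hr1, hr2⟩ := exists_rat_btwn (show q < q + ε by simpa using hε)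
    refine (iInf₂_le (r : ℝ) ⟨hq.trans hr1, hlt r hr1⟩).trans ?_
    refine (ENNReal.ofReal_le_ofReal hr2.le).trans ?_
    rw [ENNReal.ofReal_add hq.le ε.coe_nonneg, ENNReal.ofReal_coe_nnreal]
  · by_contra! hpq
    obtain ⟨r, hr1, hr2⟩ := exists_rat_btwn hpq
    exact (pVariation_lt_top_mono hp hr1.le hw hpw).ne
      (hgt r (by exact_mod_cast hp.trans hr1) hr2)

/-! ### Measurability of the variation index -/

theorem Dense.iSup_subtype_eq {D E : Type*} [TopologicalSpace D] [TopologicalSpace E]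
    [CompleteLinearOrder E] [OrderTopology E] {s : Set D} (hs : Dense s) {g : D → E}
    (hg : Continuous g) : ⨆ x ∈ s, g x = ⨆ x, g x := by
  refine le_antisymm (iSup₂_le fun x _ => le_iSup g x) (iSup_le fun x => ?_)
  have hcl : IsClosed {x | g x ≤ ⨆ y ∈ s, g y} := isClosed_le hg continuous_const
  have : closure s ⊆ {x | g x ≤ ⨆ y ∈ s, g y} :=
    hcl.closure_subset_iff.2 fun y hy => le_iSup₂ (f := fun y (_ : y ∈ s) => g y) y hy
  exact this (hs x)

theorem PathSpace.measurable_eval (t : unitInterval) : Measurable fun w : PathSpace => w t :=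
  measurable_iff_comap_le.2 (le_iSup (fun t : unitInterval =>
    MeasurableSpace.comap (fun w : PathSpace => w t) inferInstance) t)

/-- For fixed n the sum depends continuously on the partition, so the supremum may be taken over a
countable dense set of partitions. -/
theorem measurable_pVariation {p : ℝ} (hp : 0 < p) :
    Measurable fun w : PathSpace => pVariation p w := by
  refine Measurable.iSup fun n => ?_
  let D := {t : Fin (n + 1) → unitInterval // StrictMono t ∧ t 0 = 0 ∧ t (Fin.last n) = 1}
  let g : PathSpace → D → ℝ≥0∞ := fun w t =>
    ∑ k : Fin n, ENNReal.ofReal (|w (t.1 k.succ) - w (t.1 k.castSucc)| ^ p)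
  have hg : ∀ w, Continuous (g w) := fun w => by
    refine continuous_finsetSum _ fun k _ => ENNReal.continuous_ofReal.comp ?_
    have h : ∀ j : Fin (n + 1), Continuous fun t : D => w (t.1 j) := fun j =>
      w.continuous_toFun.comp ((continuous_apply j).comp continuous_subtype_val)
    exact ((h _).sub (h _)).abs.rpow_const fun _ => Or.inr hp.le
  obtain ⟨s, hsc, hsd⟩ := TopologicalSpace.exists_countable_dense D
  have : (fun w : PathSpace => ⨆ (t : Fin (n + 1) → unitInterval)
      (_ : StrictMono t ∧ t 0 = 0 ∧ t (Fin.last n) = 1),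
      ∑ k : Fin n, ENNReal.ofReal (|w (t k.succ) - w (t k.castSucc)| ^ p)) =
      fun w => ⨆ t ∈ s, g w t := by
    funext w
    rw [hsd.iSup_subtype_eq (hg w)]
    exact (iSup_subtype (f := g w)).symm
  rw [this]
  refine Measurable.biSup s hsc fun t _ => Finset.measurable_sum _ fun k _ => ?_
  exact ENNReal.measurable_ofReal.comp ((((PathSpace.measurable_eval _).sub
    (PathSpace.measurable_eval _)).abs).pow_const p)

theorem pVariationIndex_eq_iInf_rat {w : unitInterval → ℝ} (hw : Continuous w) :
    pVariationIndex w = ⨅ (r : ℚ) (_ : 0 < r),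
      if pVariation r w < ∞ then ENNReal.ofReal r else ∞ := by
  refine le_antisymm (le_iInf₂ fun r hr => ?_) (le_iInf fun p => le_iInf fun ⟨hp, hpw⟩ => ?_)
  · split_ifs with h
    · exact iInf₂_le (r : ℝ) ⟨by exact_mod_cast hr, h⟩
    · exact le_top
  · refine ENNReal.le_of_forall_pos_le_add fun ε hε _ => ?_
    obtain ⟨r, hr1, hr2⟩ := exists_rat_btwn (show p < p + ε by simpa using hε)
    refine (iInf₂_le r (by exact_mod_cast hp.trans hr1)).trans ?_
    rw [if_pos (pVariation_lt_top_mono hp hr1.le hw hpw)]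
    refine (ENNReal.ofReal_le_ofReal hr2.le).trans ?_
    rw [ENNReal.ofReal_add hp.le ε.coe_nonneg, ENNReal.ofReal_coe_nnreal]

theorem measurableSet_indexEvent (q : ℝ) : MeasurableSet (indexEvent q) := by
  have : Measurable fun w : PathSpace => pVariationIndex w := by
    simp_rw [fun w : PathSpace => pVariationIndex_eq_iInf_rat w.continuous_toFun]
    refine Measurable.iInf fun r => Measurable.iInf fun hr => ?_
    exact Measurable.ite (measurableSet_lt (measurable_pVariation (by exact_mod_cast hr))
      measurable_const) measurable_const measurable_const
  exact this (measurableSet_singleton _)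

theorem disjoint_indexEvent {q r : ℝ} (hq : 0 < q) (hqr : q < r) :
    Disjoint (indexEvent q) (indexEvent r) := by
  rw [Set.disjoint_left]
  intro w h1 h2
  have h : ENNReal.ofReal q = ENNReal.ofReal r := h1.symm.trans h2
  exact hqr.ne ((ENNReal.ofReal_eq_ofReal_iff hq.le (hq.trans hqr).le).1 h)

/-! ### Hölder continuity from dyadic increments and moments -/

/-- The largest dyadic number of level `n` that does not exceed `t`. -/
def dyadicFloor (n : ℕ) (t : ℝ≥0) : ℝ≥0 := ⌊2 ^ n * t⌋₊ / 2 ^ n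

theorem dyadicFloor_le (n : ℕ) (t : ℝ≥0) : dyadicFloor n t ≤ t := by
  rw [dyadicFloor, div_le_iff₀' (by positivity)]
  exact Nat.floor_le (by positivity)

theorem tendsto_dyadicFloor (t : ℝ≥0) : Tendsto (fun n => dyadicFloor n t) atTop (𝓝 t) := by
  have h : Tendsto (fun n : ℕ => t - (1 / 2 : ℝ≥0) ^ n) atTop (𝓝 (t - 0)) :=
    tendsto_const_nhds.sub (NNReal.tendsto_pow_atTop_nhds_zero_of_lt_one
      (by rw [div_lt_one] <;> norm_num))
  rw [tsub_zero] at h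
  refine tendsto_of_tendsto_of_tendsto_of_le_of_le h tendsto_const_nhds (fun n => ?_)
    fun n => dyadicFloor_le n t
  simp only [dyadicFloor]
  rw [tsub_le_iff_right, one_div, inv_pow, ← one_div, ← add_div, le_div_iff₀' (by positivity)]
  exact (Nat.lt_floor_add_one _).le

/-- Chaining: successive dyadic floors of a point differ by at most one cell, which gives a
geometric tail from each point to its level n floor, and the two level n floors are equal or
adjacent. -/
theorem abs_sub_le_of_dyadic {f : ℝ≥0 → ℝ} (hf : Continuous f) {C ρ : ℝ} (hρ0 : 0 < ρ)
    (hρ1 : ρ < 1) (hC : 0 ≤ C)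
    (h : ∀ n k : ℕ, k < 2 ^ n → |f ((k + 1) / 2 ^ n) - f (k / 2 ^ n)| ≤ C * ρ ^ n)
    {n : ℕ} {s t : ℝ≥0} (hst : s ≤ t) (ht : t ≤ 1) (hn : (t : ℝ) - s ≤ (1 / 2) ^ n) :
    |f t - f s| ≤ C * (1 + 2 / (1 - ρ)) * ρ ^ n := by
  have htail : ∀ x : ℝ≥0, x ≤ 1 → |f (dyadicFloor n x) - f x| ≤ C * ρ ^ n / (1 - ρ) := by
    intro x hx
    refine dist_le_of_le_geometric_of_tendsto ρ C hρ1 (f := fun n => f (dyadicFloor n x))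
      (fun m => ?_) ((hf.tendsto x).comp (tendsto_dyadicFloor x)) n
    obtain ⟨j, hj⟩ : ∃ j, j = ⌊2 ^ m * x⌋₊ := ⟨_, rfl⟩
    have h1 : (j : ℝ≥0) ≤ 2 ^ m * x := hj ▸ Nat.floor_le (by positivity)
    have h2 : 2 ^ m * x < (j : ℝ≥0) + 1 := hj ▸ Nat.lt_floor_add_one _
    have e0 : dyadicFloor m x = (2 * j : ℕ) / 2 ^ (m + 1) := by
      rw [dyadicFloor, ← hj, pow_succ']
      push_cast
      rw [mul_div_mul_left _ _ two_ne_zero]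
    have hle : 2 * j ≤ ⌊2 ^ (m + 1) * x⌋₊ := Nat.le_floor <| by
      rw [pow_succ', mul_assoc]; push_cast; gcongr
    have hlt : ⌊2 ^ (m + 1) * x⌋₊ < 2 * j + 2 := (Nat.floor_lt (by positivity)).2 <| by
      rw [pow_succ', mul_assoc]; push_cast
      calc 2 * (2 ^ m * x) < 2 * ((j : ℝ≥0) + 1) := by gcongr
        _ = _ := by ring
    rcases (show ⌊2 ^ (m + 1) * x⌋₊ = 2 * j ∨ ⌊2 ^ (m + 1) * x⌋₊ = 2 * j + 1 by omega) with e | e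
    · rw [e0, dyadicFloor, e, dist_self]; positivity
    · have hk : 2 * j < 2 ^ (m + 1) := by
        have h3 : ((⌊2 ^ (m + 1) * x⌋₊ : ℕ) : ℝ≥0) ≤ 2 ^ (m + 1) * x :=
          Nat.floor_le (by positivity)
        have h4 : 2 ^ (m + 1) * x ≤ 2 ^ (m + 1) * 1 := by gcongr
        rw [e, mul_one] at *
        have h5 : 2 * j + 1 ≤ 2 ^ (m + 1) := by exact_mod_cast h3.trans h4
        omega
      rw [e0, dyadicFloor, e, dist_comm, Real.dist_eq]
      push_cast
      have := h (m + 1) (2 * j) hk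
      push_cast at this
      refine this.trans ?_
      rw [pow_succ]
      have : ρ ^ m * ρ ≤ ρ ^ m := mul_le_of_le_one_right (by positivity) hρ1.le
      gcongr
  have hmid : |f (dyadicFloor n t) - f (dyadicFloor n s)| ≤ C * ρ ^ n := by
    have hle : ⌊2 ^ n * s⌋₊ ≤ ⌊2 ^ n * t⌋₊ := Nat.floor_mono (by gcongr)
    have hlt : ⌊2 ^ n * t⌋₊ < ⌊2 ^ n * s⌋₊ + 2 := (Nat.floor_lt (by positivity)).2 <| by
      have h1 : 2 ^ n * s < (⌊2 ^ n * s⌋₊ : ℝ≥0) + 1 := Nat.lt_floor_add_one _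
      have h2 : 2 ^ n * t ≤ 2 ^ n * s + 1 := by
        rw [← NNReal.coe_le_coe]; push_cast
        have := mul_le_mul_of_nonneg_left hn (by positivity : (0 : ℝ) ≤ 2 ^ n)
        rw [← mul_pow] at this
        norm_num at this
        linarith
      push_cast
      calc 2 ^ n * t ≤ 2 ^ n * s + 1 := h2
        _ < (⌊2 ^ n * s⌋₊ : ℝ≥0) + 1 + 1 := by gcongr
        _ = _ := by ring
    rcases (show ⌊2 ^ n * t⌋₊ = ⌊2 ^ n * s⌋₊ ∨ ⌊2 ^ n * t⌋₊ = ⌊2 ^ n * s⌋₊ + 1 by omega) with e | e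
    · rw [dyadicFloor, dyadicFloor, e, sub_self, abs_zero]; positivity
    · rw [dyadicFloor, dyadicFloor, e]
      push_cast
      refine h n _ ?_
      have h3 : ((⌊2 ^ n * t⌋₊ : ℕ) : ℝ≥0) ≤ 2 ^ n * t := Nat.floor_le (by positivity)
      have h4 : 2 ^ n * t ≤ 2 ^ n * 1 := by gcongr
      rw [mul_one] at h4
      have h5 : ⌊2 ^ n * t⌋₊ ≤ 2 ^ n := by exact_mod_cast h3.trans h4
      omega
  have ht' := htail t ht
  have hs' := htail s (hst.trans ht)
  have : f t - f s = -(f (dyadicFloor n t) - f t) + (f (dyadicFloor n t) - f (dyadicFloor n s))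
      + (f (dyadicFloor n s) - f s) := by ring
  rw [this]
  refine (abs_add_three _ _ _).trans ?_
  rw [abs_neg]
  have e : C * (1 + 2 / (1 - ρ)) * ρ ^ n = C * ρ ^ n + 2 * (C * ρ ^ n / (1 - ρ)) := by ring
  linarith

theorem holder_of_dyadic {f : ℝ≥0 → ℝ} (hf : Continuous f) {C γ : ℝ} (hγ : 0 < γ) (hC : 0 ≤ C)
    (h : ∀ n k : ℕ, k < 2 ^ n →
      |f ((k + 1) / 2 ^ n) - f (k / 2 ^ n)| ≤ C * ((1 / 2 : ℝ) ^ γ) ^ n) :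
    ∃ K : ℝ, ∀ s t : ℝ≥0, s ≤ t → t ≤ 1 → |f t - f s| ≤ K * ((t : ℝ) - s) ^ γ := by
  set ρ : ℝ := (1 / 2 : ℝ) ^ γ with hρ
  have hρ0 : 0 < ρ := by positivity
  have hρ1 : ρ < 1 := Real.rpow_lt_one (by norm_num) (by norm_num) hγ
  refine ⟨C * (1 + 2 / (1 - ρ)) / ρ, fun s t hst ht => ?_⟩
  rcases hst.eq_or_lt with rfl | hlt
  · simp [Real.zero_rpow hγ.ne']
  have hx0 : (0 : ℝ) < t - s := sub_pos.2 (by exact_mod_cast hlt)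
  have hx1 : (t : ℝ) - s ≤ 1 := by
    have : (t : ℝ) ≤ 1 := by exact_mod_cast ht
    linarith [s.coe_nonneg]
  -- Here 2^(-n-1) < t - s ≤ 2^(-n); passing from ρ^n to ρ^(n+1) costs the factor 1/ρ in the
  -- constant.
  obtain ⟨n, hn1, hn2⟩ := exists_nat_pow_near_of_lt_one hx0 hx1 (by norm_num : (0 : ℝ) < 1 / 2)
    (by norm_num)
  refine (abs_sub_le_of_dyadic hf hρ0 hρ1 hC h hst ht hn2).trans ?_
  have h1 : 0 < 1 - ρ := sub_pos.2 hρ1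
  rw [div_mul_eq_mul_div, le_div_iff₀ hρ0, mul_assoc, ← pow_succ]
  gcongr
  calc ρ ^ (n + 1) = ((1 / 2 : ℝ) ^ (n + 1)) ^ γ := by
        rw [hρ, ← Real.rpow_natCast, ← Real.rpow_mul (by norm_num), mul_comm,
          Real.rpow_mul (by norm_num), Real.rpow_natCast]
    _ ≤ _ := by gcongr

/-- Kolmogorov–Chentsov. At level n there are 2^n increments, each contributing at most K 2^(nγq)
2^(-n(1+r)) to the expectation of F n, so these expectations are summable when γq < r. -/
theorem ae_holder_of_moment {Ω : Type*} [MeasurableSpace Ω] {P : Measure Ω}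
    {Y : ℝ≥0 → Ω → ℝ} (hYm : ∀ t, Measurable (Y t))
    (hYc : ∀ ω, Continuous fun t => Y t ω) {q r γ : ℝ} (hq : 0 < q) (hγ : 0 < γ)
    (hr : γ * q < r) {K : ℝ≥0∞} (hK : K ≠ ∞)
    (h : ∀ s t : ℝ≥0, s ≤ t → t ≤ 1 → ∫⁻ ω, ENNReal.ofReal (|Y t ω - Y s ω| ^ q) ∂P ≤
      K * ENNReal.ofReal (((t : ℝ) - s) ^ (1 + r))) :
    ∀ᵐ ω ∂P, ∃ C : ℝ, ∀ s t : ℝ≥0, s ≤ t → t ≤ 1 → |Y t ω - Y s ω| ≤ C * ((t : ℝ) - s) ^ γ := by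
  let a : ℕ → ℝ := fun n => ((1 / 2 : ℝ) ^ γ) ^ n
  have ha : ∀ n, 0 < a n := fun n => by positivity
  let F : ℕ → Ω → ℝ≥0∞ := fun n ω => ∑ k ∈ Finset.range (2 ^ n),
    ENNReal.ofReal ((a n ^ q)⁻¹ * |Y ((k + 1) / 2 ^ n) ω - Y (k / 2 ^ n) ω| ^ q)
  have hFm : ∀ n, Measurable (F n) := fun n => by
    refine Finset.measurable_sum _ fun k _ => ENNReal.measurable_ofReal.comp ?_
    exact measurable_const.mul ((((hYm _).sub (hYm _)).abs).pow_const q)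
  have hF : ∀ n, ∫⁻ ω, F n ω ∂P ≤ K * ENNReal.ofReal ((1 / 2 : ℝ) ^ (r - γ * q)) ^ n := by
    intro n
    simp only [F]
    rw [lintegral_finsetSum _ fun k _ => ?_]
    swap
    · exact ENNReal.measurable_ofReal.comp
        (measurable_const.mul ((((hYm _).sub (hYm _)).abs).pow_const q))
    have hk : ∀ k ∈ Finset.range (2 ^ n),
        ∫⁻ ω, ENNReal.ofReal ((a n ^ q)⁻¹ * |Y ((k + 1) / 2 ^ n) ω - Y (k / 2 ^ n) ω| ^ q) ∂P ≤
        ENNReal.ofReal (a n ^ q)⁻¹ * (K * ENNReal.ofReal (((1 / 2 : ℝ) ^ n) ^ (1 + r))) := by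
      intro k hk
      have hk' : k + 1 ≤ 2 ^ n := Finset.mem_range.1 hk
      have hpos : 0 ≤ (a n ^ q)⁻¹ := by have := ha n; positivity
      simp_rw [ENNReal.ofReal_mul hpos]
      have hmeas : Measurable fun ω => ENNReal.ofReal
          (|Y ((k + 1) / 2 ^ n) ω - Y (k / 2 ^ n) ω| ^ q) :=
        ENNReal.measurable_ofReal.comp ((((hYm _).sub (hYm _)).abs).pow_const q)
      rw [lintegral_const_mul _ hmeas]
      gcongr
      refine (h _ _ (by gcongr; exact le_self_add) ?_).trans (le_of_eq ?_)
      · rw [div_le_one (by positivity)]; exact_mod_cast hk'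
      · congr 3
        push_cast
        rw [one_div, inv_pow]
        ring
    refine (Finset.sum_le_sum hk).trans (le_of_eq ?_)
    rw [Finset.sum_const, Finset.card_range, nsmul_eq_mul, mul_left_comm _ K, mul_left_comm _ K]
    congr 1
    rw [← ENNReal.ofReal_mul (by have := ha n; positivity), ← ENNReal.ofReal_natCast,
      ← ENNReal.ofReal_mul (by positivity), ← ENNReal.ofReal_pow (by positivity)]
    congr 1
    simp only [a]
    have h2 : (0 : ℝ) < 1 / 2 := by norm_num
    have e2 : (((2 ^ n : ℕ)) : ℝ) = (1 / 2 : ℝ) ^ (-(n : ℝ)) := by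
      rw [Real.rpow_neg h2.le, Real.rpow_natCast]; simp
    rw [e2]
    simp only [← Real.rpow_natCast, ← Real.rpow_mul h2.le, ← Real.rpow_neg h2.le,
      ← Real.rpow_add h2]
    congr 1
    ring
  have hsum : ∫⁻ ω, ∑' n, F n ω ∂P < ∞ := by
    rw [lintegral_tsum fun n => (hFm n).aemeasurable]
    refine (ENNReal.tsum_le_tsum hF).trans_lt ?_
    rw [ENNReal.tsum_mul_left, ENNReal.tsum_geometric]
    refine ENNReal.mul_lt_top hK.lt_top (ENNReal.inv_lt_top.2 (tsub_pos_iff_lt.2 ?_))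
    rw [ENNReal.ofReal_lt_one]
    exact Real.rpow_lt_one (by norm_num) (by norm_num) (by linarith)
  filter_upwards [ae_lt_top (Measurable.tsum hFm) hsum.ne] with ω hω
  set Z := ∑' n, F n ω
  -- Every single normalised term is at most the total sum Z, so one constant serves all levels.
  refine holder_of_dyadic (hYc ω) hγ (C := Z.toReal ^ (1 / q)) (by positivity) fun n k hk => ?_
  set d := |Y ((k + 1) / 2 ^ n) ω - Y (k / 2 ^ n) ω|
  have hd : 0 ≤ d := abs_nonneg _
  have h1 : ENNReal.ofReal ((a n ^ q)⁻¹ * d ^ q) ≤ Z :=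
    (Finset.single_le_sum (f := fun k : ℕ => ENNReal.ofReal
      ((a n ^ q)⁻¹ * |Y ((k + 1) / 2 ^ n) ω - Y (k / 2 ^ n) ω| ^ q)) (fun _ _ => zero_le)
      (Finset.mem_range.2 hk)).trans (ENNReal.le_tsum n)
  have h2 : (a n ^ q)⁻¹ * d ^ q ≤ Z.toReal := (ENNReal.ofReal_le_iff_le_toReal hω.ne).1 h1
  have h3 : d ^ q ≤ Z.toReal * a n ^ q := by
    rwa [inv_mul_le_iff₀ (Real.rpow_pos_of_pos (ha n) q), mul_comm] at h2
  calc d = (d ^ q) ^ (1 / q) := by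
        rw [← Real.rpow_mul hd, mul_one_div_cancel hq.ne', Real.rpow_one]
    _ ≤ (Z.toReal * a n ^ q) ^ (1 / q) := by gcongr
    _ = _ := by
        rw [Real.mul_rpow ENNReal.toReal_nonneg (Real.rpow_nonneg (ha n).le _),
          ← Real.rpow_mul (ha n).le, mul_one_div_cancel hq.ne', Real.rpow_one]

/-! ### Processes with scaling increments -/

/-- The increment over `[s, t]` is distributed as `(t - s) ^ H` times a variable with law `ν`. -/
def HasScalingIncrements {Ω : Type*} [MeasurableSpace Ω] (Y : ℝ≥0 → Ω → ℝ) (H : ℝ)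
    (ν : Measure ℝ) (P : Measure Ω) : Prop :=
  ∀ s t : ℝ≥0, s ≤ t →
    P.map (fun ω => Y t ω - Y s ω) = ν.map fun x => ((t : ℝ) - s) ^ H * x

theorem HasScalingIncrements.ae_holder {Ω : Type*} [MeasurableSpace Ω] {P : Measure Ω}
    {Y : ℝ≥0 → Ω → ℝ} {H : ℝ} {ν : Measure ℝ}
    (hY : HasScalingIncrements Y H ν P) (hYm : ∀ t, Measurable (Y t))
    (hYc : ∀ ω, Continuous fun t => Y t ω)
    (hmom : ∀ m : ℕ, ∫⁻ x, ENNReal.ofReal (x ^ (2 * m)) ∂ν ≠ ∞)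
    {γ : ℝ} (hγ : 0 < γ) (hγH : γ < H) :
    ∀ᵐ ω ∂P, ∀ N : ℕ, ∃ C : ℝ, ∀ s t : ℝ≥0, s ≤ t → t ≤ N →
      |Y t ω - Y s ω| ≤ C * ((t : ℝ) - s) ^ γ := by
  have key : ∀ᵐ ω ∂P, ∀ N : ℕ, ∃ C : ℝ, ∀ s t : ℝ≥0, s ≤ t → t ≤ 1 →
      |Y (N * t) ω - Y (N * s) ω| ≤ C * ((t : ℝ) - s) ^ γ := by
    rw [ae_all_iff]
    intro N
    -- Large enough that 2mγ < 2mH - 1, where 2m is the moment used.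
    obtain ⟨m, hm⟩ := exists_nat_gt (1 / (H - γ))
    have hHγ : 0 < H - γ := sub_pos.2 hγH
    rw [div_lt_iff₀ hHγ] at hm
    have hm0 : (0 : ℝ) < m := by
      by_contra! hcon
      nlinarith
    have hq : (0 : ℝ) < 2 * m := by positivity
    refine ae_holder_of_moment (fun t => hYm (N * t))
      (fun ω => (hYc ω).comp (continuous_const.mul continuous_id)) hq hγ
      (r := H * (2 * m) - 1) (by nlinarith)
      (K := ENNReal.ofReal ((N : ℝ) ^ (H * (2 * m))) * ∫⁻ x, ENNReal.ofReal (x ^ (2 * m)) ∂ν)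
      (ENNReal.mul_ne_top ENNReal.ofReal_ne_top (hmom m)) fun s t hst _ => ?_
    have hst' : (0 : ℝ) ≤ t - s := sub_nonneg.2 (by exact_mod_cast hst)
    have hmeas : Measurable fun x : ℝ => ENNReal.ofReal (|x| ^ (2 * m : ℝ)) := by fun_prop
    have h1 : ∫⁻ ω, ENNReal.ofReal (|Y (N * t) ω - Y (N * s) ω| ^ (2 * m : ℝ)) ∂P =
        ∫⁻ x, ENNReal.ofReal (|x| ^ (2 * m : ℝ)) ∂(P.map fun ω => Y (N * t) ω - Y (N * s) ω) :=
      (lintegral_map hmeas ((hYm _).sub (hYm _))).symm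
    rw [h1, hY _ _ (by gcongr), lintegral_map hmeas (by fun_prop)]
    have h2 : ∀ x : ℝ,
        ENNReal.ofReal (|(((N * t : ℝ≥0) : ℝ) - (N * s : ℝ≥0)) ^ H * x| ^ (2 * m : ℝ))
        = ENNReal.ofReal ((N : ℝ) ^ (H * (2 * m)) * ((t : ℝ) - s) ^ (1 + (H * (2 * m) - 1))) *
          ENNReal.ofReal (x ^ (2 * m)) := by
      intro x
      rw [← ENNReal.ofReal_mul (by positivity)]
      congr 1
      push_cast
      rw [← mul_sub, Real.mul_rpow (by positivity) hst', abs_mul,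
        abs_of_nonneg (by positivity), Real.mul_rpow (by positivity) (abs_nonneg _),
        Real.mul_rpow (by positivity) (by positivity), ← Real.rpow_mul (by positivity),
        ← Real.rpow_mul hst']
      congr 1
      · congr 2; ring
      · rw [show (2 * m : ℝ) = ((2 * m : ℕ) : ℝ) by push_cast; rfl, Real.rpow_natCast,
          pow_mul, sq_abs, pow_mul]
    simp_rw [h2]
    rw [lintegral_const_mul _ (by fun_prop), ENNReal.ofReal_mul (by positivity)]
    exact le_of_eq (by ring)
  filter_upwards [key] with ω hω N
  -- Rescaling by N + 1 instead of N avoids division by zero.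
  obtain ⟨C, hC⟩ := hω (N + 1)
  refine ⟨C / (N + 1 : ℝ) ^ γ, fun s t hst ht => ?_⟩
  have hN : (N + 1 : ℝ≥0) ≠ 0 := by positivity
  have h1 := hC (s / (N + 1)) (t / (N + 1)) (by gcongr)
    ((div_le_one (by positivity)).2 (ht.trans le_self_add))
  push_cast at h1
  rw [mul_div_cancel₀ _ hN, mul_div_cancel₀ _ hN, ← sub_div, Real.div_rpow
    (sub_nonneg.2 (by exact_mod_cast hst)) (by positivity)] at h1
  rwa [div_mul_eq_mul_div, ← mul_div_assoc'] 

theorem exists_abs_le_measure_lt {ν : Measure ℝ} [IsFiniteMeasure ν] (h0 : ν {0} = 0)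
    {δ : ℝ≥0∞} (hδ : 0 < δ) : ∃ ε : ℝ, 0 < ε ∧ ν {x | |x| ≤ ε} < δ := by
  have hanti : Antitone fun m : ℕ => {x : ℝ | |x| ≤ 1 / (m + 1 : ℝ)} := fun m n hmn x hx =>
    le_trans (show |x| ≤ _ from hx) (Nat.one_div_le_one_div hmn)
  have hlim := tendsto_measure_iInter_atTop (μ := ν) (fun m => (measurableSet_le
    (measurable_norm (α := ℝ)) measurable_const).nullMeasurableSet) hanti ⟨0, measure_ne_top _ _⟩
  have e : ⋂ m : ℕ, {x : ℝ | |x| ≤ 1 / (m + 1 : ℝ)} = {0} := by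
    ext x
    simp only [mem_iInter, mem_ofPred_eq, mem_singleton_iff]
    refine ⟨fun h => ?_, fun h m => by rw [h, abs_zero]; positivity⟩
    have := ge_of_tendsto' (tendsto_one_div_add_atTop_nhds_zero_nat (𝕜 := ℝ)) h
    exact abs_nonpos_iff.1 this
  change Tendsto _ _ (𝓝 (ν (⋂ m : ℕ, {x : ℝ | |x| ≤ 1 / (m + 1 : ℝ)}))) at hlim
  rw [e, h0] at hlim
  obtain ⟨m, hm⟩ := (hlim.eventually (gt_mem_nhds hδ)).exists
  exact ⟨_, by positivity, hm⟩

/-- After scaling, an increment bounded by C h^κ means |y| ≤ C h^(κ-H) under ν. These intervals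
shrink to {0}, which is ν-null. -/
theorem HasScalingIncrements.ae_not_bounded {Ω : Type*} [MeasurableSpace Ω] {P : Measure Ω}
    {Y : ℝ≥0 → Ω → ℝ} {H : ℝ} {ν : Measure ℝ}
    [IsFiniteMeasure ν] (hY : HasScalingIncrements Y H ν P) (hYm : ∀ t, Measurable (Y t))
    (h0 : ν {0} = 0) {κ : ℝ} (hκ : H < κ) (x : ℝ≥0) :
    ∀ᵐ ω ∂P, ¬ ∃ C : ℕ, ∀ᶠ n : ℕ in atTop,
      |Y (x + (1 / (n + 1 : ℝ≥0))) ω - Y x ω| ≤ C * (1 / (n + 1 : ℝ)) ^ κ := by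
  simp only [eventually_atTop, not_exists]
  rw [ae_all_iff]; intro C
  rw [ae_all_iff]; intro N
  change P {ω | ¬ ¬ _} = 0
  simp only [not_not]
  by_contra hne
  -- The threshold is the measure of the event itself, which will be contained in an event of
  -- smaller measure.
  obtain ⟨ε, hε, hlt⟩ := exists_abs_le_measure_lt h0 (pos_iff_ne_zero.2 hne)
  have hlim : Tendsto (fun n : ℕ => (C : ℝ) * (1 / (n + 1 : ℝ)) ^ (κ - H)) atTop (𝓝 0) := by
    have h := (tendsto_one_div_add_atTop_nhds_zero_nat (𝕜 := ℝ)).rpow_const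
      (p := κ - H) (Or.inr (sub_pos.2 hκ).le)
    rw [Real.zero_rpow (sub_pos.2 hκ).ne'] at h
    simpa using h.const_mul (C : ℝ)
  obtain ⟨n, hnN, hn⟩ := ((eventually_ge_atTop N).and (hlim.eventually (gt_mem_nhds hε))).exists
  refine absurd hlt (not_lt.2 ?_)
  have hh : (0 : ℝ) < 1 / (n + 1 : ℝ) := by positivity
  have hmeas : MeasurableSet {y : ℝ | |y| ≤ C * (1 / (n + 1 : ℝ)) ^ κ} :=
    measurableSet_le (measurable_norm (α := ℝ)) measurable_const
  calc P {ω | ∀ b ≥ N, |Y (x + (1 / (b + 1 : ℝ≥0))) ω - Y x ω| ≤ C * (1 / (b + 1 : ℝ)) ^ κ}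
      ≤ P {ω | |Y (x + (1 / (n + 1 : ℝ≥0))) ω - Y x ω| ≤ C * (1 / (n + 1 : ℝ)) ^ κ} :=
        measure_mono fun ω hω => hω n hnN
    _ = P.map (fun ω => Y (x + (1 / (n + 1 : ℝ≥0))) ω - Y x ω)
          {y : ℝ | |y| ≤ C * (1 / (n + 1 : ℝ)) ^ κ} := by
        exact (Measure.map_apply ((hYm _).sub (hYm _)) hmeas).symm
    _ = ν ((fun y => (1 / (n + 1 : ℝ)) ^ H * y) ⁻¹' {y : ℝ | |y| ≤ C * (1 / (n + 1 : ℝ)) ^ κ}) := by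
        rw [hY _ _ le_self_add, Measure.map_apply (by fun_prop) hmeas]
        congr 3
        push_cast
        ring_nf
    _ ≤ ν {y | |y| ≤ ε} := by
        refine measure_mono fun y hy => ?_
        simp only [mem_preimage, mem_ofPred_eq] at hy ⊢
        rw [abs_mul, abs_of_pos (Real.rpow_pos_of_pos hh H), ← le_div_iff₀'
          (Real.rpow_pos_of_pos hh H), mul_div_assoc, ← Real.rpow_sub hh] at hy
        exact hy.trans hn.le

theorem measurableSet_rate_bounded {Ω : Type*} [MeasurableSpace Ω] {Y : ℝ≥0 → Ω → ℝ}
    (hYm : ∀ t, Measurable (Y t)) (hYc : ∀ ω, Continuous fun t => Y t ω) (κ : ℝ) :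
    MeasurableSet {z : Ω × ℝ | ∃ C : ℕ, ∀ᶠ n : ℕ in atTop,
      |Y (z.2.toNNReal + (1 / (n + 1 : ℝ≥0))) z.1 - Y z.2.toNNReal z.1| ≤
        C * (1 / (n + 1 : ℝ)) ^ κ} := by
  have hjm : Measurable fun z : Ω × ℝ≥0 => Y z.2 z.1 :=
    (measurable_uncurry_of_continuous_of_measurable hYc hYm).comp measurable_swap
  have hA : ∀ C n : ℕ, MeasurableSet {z : Ω × ℝ |
      |Y (z.2.toNNReal + (1 / (n + 1 : ℝ≥0))) z.1 - Y z.2.toNNReal z.1| ≤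
        C * (1 / (n + 1 : ℝ)) ^ κ} := fun C n => by
    have h1 : Measurable fun z : Ω × ℝ => Y (z.2.toNNReal + (1 / (n + 1 : ℝ≥0))) z.1 :=
      hjm.comp (measurable_fst.prodMk ((measurable_real_toNNReal.comp measurable_snd).add_const _))
    have h2 : Measurable fun z : Ω × ℝ => Y z.2.toNNReal z.1 :=
      hjm.comp (measurable_fst.prodMk (measurable_real_toNNReal.comp measurable_snd))
    exact measurableSet_le (h1.sub h2).norm measurable_const
  have e : {z : Ω × ℝ | ∃ C : ℕ, ∀ᶠ n : ℕ in atTop,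
      |Y (z.2.toNNReal + (1 / (n + 1 : ℝ≥0))) z.1 - Y z.2.toNNReal z.1| ≤
        C * (1 / (n + 1 : ℝ)) ^ κ} = ⋃ (C : ℕ) (N : ℕ), ⋂ (n : ℕ) (_ : n ≥ N), {z : Ω × ℝ |
      |Y (z.2.toNNReal + (1 / (n + 1 : ℝ≥0))) z.1 - Y z.2.toNNReal z.1| ≤
        C * (1 / (n + 1 : ℝ)) ^ κ} := by
    ext z
    simp only [eventually_atTop, mem_ofPred_eq, mem_iUnion, mem_iInter]
  rw [e]
  exact MeasurableSet.iUnion fun C => MeasurableSet.iUnion fun N =>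
    MeasurableSet.iInter fun n => MeasurableSet.iInter fun _ => hA C n

/-- By Fubini, almost every path violates the rate h^(1/p) at almost every x. Finite variation would
impose that rate at almost every x in (0, T), an interval of positive length. -/
theorem HasScalingIncrements.ae_seqVariation_eq_top {Ω : Type*} [MeasurableSpace Ω] {P : Measure Ω}
    [SFinite P] {Y : ℝ≥0 → Ω → ℝ} {H : ℝ}
    {ν : Measure ℝ} [IsFiniteMeasure ν] (hY : HasScalingIncrements Y H ν P)
    (hYm : ∀ t, Measurable (Y t)) (hYc : ∀ ω, Continuous fun t => Y t ω)
    (h0 : ν {0} = 0) {p : ℝ} (hp : 0 < p) (hpH : H < 1 / p) {T : ℝ≥0} (hT : 0 < T) :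
    ∀ᵐ ω ∂P, seqVariation p (fun t => Y t ω) T = ∞ := by
  have hx : ∀ᵐ x : ℝ, ∀ᵐ ω ∂P, (ω, x) ∈ {z : Ω × ℝ | ∃ C : ℕ, ∀ᶠ n : ℕ in atTop,
      |Y (z.2.toNNReal + (1 / (n + 1 : ℝ≥0))) z.1 - Y z.2.toNNReal z.1| ≤
        C * (1 / (n + 1 : ℝ)) ^ (1 / p)}ᶜ :=
    Eventually.of_forall fun x => hY.ae_not_bounded hYm h0 hpH x.toNNReal
  have hae := (Measure.ae_ae_comm (μ := P) (ν := volume)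
    (measurableSet_rate_bounded hYm hYc (1 / p)).compl).2 hx
  filter_upwards [hae] with ω hω
  by_contra hne
  have hfin := ae_increment_le_of_seqVariation_lt_top hp (lt_top_iff_ne_top.2 hne)
  have hempty : ∀ᵐ x : ℝ, x ∉ Ioo (0 : ℝ) T := by
    filter_upwards [hω, hfin] with x h1 h2 h3
    exact h1 (h2 h3)
  have : volume (Ioo (0 : ℝ) T) = 0 := measure_eq_zero_iff_ae_notMem.2 hempty
  rw [Real.volume_Ioo, ENNReal.ofReal_eq_zero] at this
  have hT' : (0 : ℝ) < T := by exact_mod_cast hT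
  linarith

/-! ### Regular versions and laws on path space -/

/-- The path is set to zero on a measurable null set. Off it, each value is a limit of measurable
representatives at dyadic times, of which there are countably many. -/
theorem exists_continuous_modification {Ω : Type*} [MeasurableSpace Ω] {P : Measure Ω}
    {Y : ℝ≥0 → Ω → ℝ} (hm : ∀ t, AEMeasurable (Y t) P)
    (hc : ∀ᵐ ω ∂P, Continuous fun t => Y t ω) (h0 : ∀ᵐ ω ∂P, Y 0 ω = 0) :
    ∃ Y' : ℝ≥0 → Ω → ℝ, (∀ t, Measurable (Y' t)) ∧ (∀ ω, Continuous fun t => Y' t ω) ∧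
      (∀ ω, Y' 0 ω = 0) ∧ ∀ᵐ ω ∂P, ∀ t, Y' t ω = Y t ω := by
  classical
  have hgood : ∀ᵐ ω ∂P, Continuous (fun t => Y t ω) ∧ Y 0 ω = 0 ∧
      ∀ n k : ℕ, Y (k / 2 ^ n) ω = (hm (k / 2 ^ n)).mk _ ω := by
    filter_upwards [hc, h0, ae_all_iff.2 fun n : ℕ => ae_all_iff.2 fun k : ℕ =>
      (hm (k / 2 ^ n)).ae_eq_mk] with ω h1 h2 h3 using ⟨h1, h2, h3⟩
  obtain ⟨N, hN, hNm, hN0⟩ := exists_measurable_superset_of_null hgood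
  have hG : ∀ ω ∉ N, Continuous (fun t => Y t ω) ∧ Y 0 ω = 0 ∧
      ∀ n k : ℕ, Y (k / 2 ^ n) ω = (hm (k / 2 ^ n)).mk _ ω := fun ω hω => by
    by_contra hcon
    exact hω (hN hcon)
  refine ⟨fun t => Nᶜ.indicator (Y t), fun t => ?_, fun ω => ?_, fun ω => ?_, ?_⟩
  · refine measurable_of_tendsto_metrizable (f := fun (n : ℕ) =>
      Nᶜ.indicator ((hm (dyadicFloor n t)).mk _))
      (fun n => (hm _).measurable_mk.indicator hNm.compl) ?_
    refine tendsto_pi_nhds.2 fun ω => ?_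
    by_cases hω : ω ∈ N
    · simp [hω]
    · simp only [indicator_of_mem (show ω ∈ Nᶜ from hω)]
      have := ((hG ω hω).1.tendsto t).comp (tendsto_dyadicFloor t)
      exact this.congr fun n => (hG ω hω).2.2 n _
  · by_cases hω : ω ∈ N
    · simpa [hω] using continuous_const
    · simpa only [indicator_of_mem (show ω ∈ Nᶜ from hω)] using (hG ω hω).1
  · by_cases hω : ω ∈ N
    · simp [hω]
    · simpa only [indicator_of_mem (show ω ∈ Nᶜ from hω)] using (hG ω hω).2.1
  · filter_upwards [measure_eq_zero_iff_ae_notMem.1 hN0] with ω hω t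
    simp only [indicator_of_mem (show ω ∈ Nᶜ from hω)]

theorem toPath_apply {Ω : Type*} {Y : ℝ≥0 → Ω → ℝ} {ω : Ω} (hc : Continuous fun t => Y t ω)
    (h0 : Y 0 ω = 0) (t : unitInterval) : toPath Y ω t = Y (unitInterval.toNNReal t) ω := by
  have h0' : Y (unitInterval.toNNReal 0) ω = 0 := by
    rwa [show unitInterval.toNNReal 0 = 0 from rfl]
  rw [toPath, dif_pos ⟨hc.comp unitInterval.toNNReal_continuous, h0'⟩]

theorem measurable_toPath {Ω : Type*} [MeasurableSpace Ω]
    {Y : ℝ≥0 → Ω → ℝ} (hm : ∀ t, Measurable (Y t))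
    (hc : ∀ ω, Continuous fun t => Y t ω) (h0 : ∀ ω, Y 0 ω = 0) : Measurable (toPath Y) := by
  refine measurable_iff_comap_le.2 ?_
  rw [PathSpace.instMeasurableSpace, MeasurableSpace.comap_iSup]
  refine iSup_le fun t => ?_
  rw [MeasurableSpace.comap_comp]
  refine measurable_iff_comap_le.1 ?_
  have : (fun w : PathSpace => w t) ∘ toPath Y = Y (unitInterval.toNNReal t) :=
    funext fun ω => toPath_apply (hc ω) (h0 ω) t
  rw [this]
  exact hm _

theorem toPath_congr {Ω : Type*} {Y Y' : ℝ≥0 → Ω → ℝ} {ω : Ω} (h : ∀ t, Y' t ω = Y t ω) :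
    toPath Y' ω = toPath Y ω := by
  have e : (fun (t : ℝ≥0) (_ : Ω) => Y' t ω) = fun t _ => Y t ω :=
    funext fun t => funext fun _ => h t
  have h' := congrArg (fun Z : ℝ≥0 → Ω → ℝ => toPath Z ω) e
  exact h'

theorem pathLaw_indexEvent_eq_one {Ω : Type*} [MeasurableSpace Ω] {P : Measure Ω}
    [IsProbabilityMeasure P] {Y Y' : ℝ≥0 → Ω → ℝ} {q : ℝ}
    (hq : 0 < q) (hm : ∀ t, Measurable (Y' t)) (hc : ∀ ω, Continuous fun t => Y' t ω)
    (h0 : ∀ ω, Y' 0 ω = 0) (hYY' : ∀ᵐ ω ∂P, ∀ t, Y' t ω = Y t ω)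
    (hlt : ∀ p : ℚ, q < p → ∀ᵐ ω ∂P,
      pVariation p (fun t => Y' (unitInterval.toNNReal t) ω) < ∞)
    (hgt : ∀ p : ℚ, 0 < p → (p : ℝ) < q → ∀ᵐ ω ∂P, seqVariation p (fun t => Y' t ω) 1 = ∞) :
    pathLaw Y P (indexEvent q) = 1 := by
  -- Measurability is available for `toPath Y'` only, as Y is regular merely almost surely.
  have e : pathLaw Y P = P.map (toPath Y') :=
    Measure.map_congr (hYY'.mono fun ω h => (toPath_congr h).symm)
  rw [e, Measure.map_apply (measurable_toPath hm hc h0) (measurableSet_indexEvent q),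
    prob_compl_eq_zero_iff₀ ((measurable_toPath hm hc h0)
      (measurableSet_indexEvent q)).nullMeasurableSet |>.symm]
  have hall : ∀ᵐ ω ∂P, toPath Y' ω ∈ indexEvent q := by
    have h1 : ∀ᵐ ω ∂P, ∀ p : ℚ, q < p →
        pVariation p (fun t => Y' (unitInterval.toNNReal t) ω) < ∞ := by
      rw [ae_all_iff]; intro p
      by_cases hp : q < p
      · exact (hlt p hp).mono fun ω h _ => h
      · exact Eventually.of_forall fun ω h => absurd h hp
    have h2 : ∀ᵐ ω ∂P, ∀ p : ℚ, 0 < p → (p : ℝ) < q →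
        seqVariation p (fun t => Y' t ω) 1 = ∞ := by
      rw [ae_all_iff]; intro p
      by_cases hp : 0 < p ∧ (p : ℝ) < q
      · exact (hgt p hp.1 hp.2).mono fun ω h _ _ => h
      · exact Eventually.of_forall fun ω h h' => absurd ⟨h, h'⟩ hp
    filter_upwards [h1, h2] with ω h1 h2
    have ew : (toPath Y' ω : unitInterval → ℝ) = fun t => Y' (unitInterval.toNNReal t) ω :=
      funext (toPath_apply (hc ω) (h0 ω))
    change pVariationIndex (toPath Y' ω) = ENNReal.ofReal q
    rw [ew]
    refine pVariationIndex_eq_of_forall hq h1 (fun p hp hpq => ?_)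
      ((hc ω).comp unitInterval.toNNReal_continuous)
    exact top_le_iff.1 ((h2 p hp hpq).symm.le.trans
      (seqVariation_one_le_pVariation (by exact_mod_cast hp) (hc ω)))
  exact hall

/-! ### Moments determine laws on the unit interval -/

/-- The exponential series of the characteristic function can be integrated termwise, being
dominated by ∑ |t|^k/k!. -/
theorem Measure.ext_of_forall_moment_eq {μ ν : Measure ℝ} [IsProbabilityMeasure μ]
    [IsProbabilityMeasure ν] (hμ : ∀ᵐ x ∂μ, |x| ≤ 1) (hν : ∀ᵐ x ∂ν, |x| ≤ 1)
    (h : ∀ k : ℕ, ∫ x, x ^ k ∂μ = ∫ x, x ^ k ∂ν) : μ = ν := by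
  have key : ∀ (μ : Measure ℝ) [IsProbabilityMeasure μ], (∀ᵐ x ∂μ, |x| ≤ 1) → ∀ t : ℝ,
      charFun μ t = ∑' k : ℕ, (t * Complex.I) ^ k / k.factorial * ((∫ x, x ^ k ∂μ : ℝ) : ℂ) := by
    intro μ _ hμ t
    let F : ℕ → ℝ → ℂ := fun k x => (t * x * Complex.I) ^ k / k.factorial
    have hb : ∀ k, ∀ᵐ x ∂μ, ‖F k x‖ ≤ |t| ^ k / k.factorial := fun k => by
      filter_upwards [hμ] with x hx
      simp only [F, norm_div, norm_pow, norm_mul, Complex.norm_I, mul_one, Complex.norm_real,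
        Real.norm_eq_abs, Complex.norm_natCast]
      gcongr
      exact mul_le_of_le_one_right (abs_nonneg t) hx
    have hFm : ∀ k, AEStronglyMeasurable (F k) μ := fun k => by
      have : Continuous (F k) := by fun_prop
      exact this.aestronglyMeasurable
    have hint : ∀ k, Integrable (F k) μ := fun k =>
      (integrable_const (|t| ^ k / k.factorial)).mono' (hFm k) (hb k)
    have hsum : Summable fun k => ∫ x, ‖F k x‖ ∂μ := by
      refine Summable.of_nonneg_of_le (fun k => integral_nonneg fun _ => norm_nonneg _)
        (fun k => ?_) (Real.summable_pow_div_factorial |t|)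
      have := integral_mono_ae (hint k).norm (integrable_const _) (hb k)
      simpa using this
    rw [charFun_apply_real]
    have h1 := (hasSum_integral_of_summable_integral_norm hint hsum).tsum_eq
    have h2 : ∀ x : ℝ, Complex.exp (t * x * Complex.I) = ∑' k, F k x := fun x => by
      rw [Complex.exp_eq_exp_ℂ, NormedSpace.exp_eq_tsum_div]
    simp_rw [h2]
    rw [← h1]
    refine tsum_congr fun k => ?_
    rw [← integral_complex_ofReal, ← integral_const_mul]
    refine integral_congr_ae (Eventually.of_forall fun x => ?_)
    simp only [F]
    push_cast
    ring
  refine Measure.ext_of_charFun (funext fun t => ?_)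
  rw [key μ hμ, key ν hν]
  simp_rw [h]

/-- The Laplace transform at the integers lists the moments of exp(-X), which lies in [0, 1]; the
logarithm recovers X. -/
theorem map_eq_of_laplace_eq {Ω : Type*} [MeasurableSpace Ω] {P : Measure Ω}
    [IsProbabilityMeasure P] {X Y : Ω → ℝ} (hX : Measurable X) (hY : Measurable Y)
    (hX0 : ∀ ω, 0 ≤ X ω) (hY0 : ∀ ω, 0 ≤ Y ω)
    (h : ∀ k : ℕ, 0 < k → ∫ ω, Real.exp (-k * X ω) ∂P = ∫ ω, Real.exp (-k * Y ω) ∂P) :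
    P.map X = P.map Y := by
  have hmX : Measurable fun ω => Real.exp (-X ω) := Real.measurable_exp.comp hX.neg
  have hmY : Measurable fun ω => Real.exp (-Y ω) := Real.measurable_exp.comp hY.neg
  have hle : MeasurableSet {x : ℝ | |x| ≤ 1} :=
    measurableSet_le (measurable_norm (α := ℝ)) measurable_const
  have habs : ∀ y : ℝ, 0 ≤ y → |Real.exp (-y)| ≤ 1 := fun y hy => by
    rw [Real.abs_exp]; exact Real.exp_le_one_iff.2 (by linarith)
  have hE : P.map (fun ω => Real.exp (-X ω)) = P.map fun ω => Real.exp (-Y ω) := by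
    have := Measure.isProbabilityMeasure_map (μ := P) hmX.aemeasurable
    have := Measure.isProbabilityMeasure_map (μ := P) hmY.aemeasurable
    refine Measure.ext_of_forall_moment_eq
      ((ae_map_iff hmX.aemeasurable hle).2 (Eventually.of_forall fun ω => habs _ (hX0 ω)))
      ((ae_map_iff hmY.aemeasurable hle).2 (Eventually.of_forall fun ω => habs _ (hY0 ω)))
      fun k => ?_
    rw [integral_map hmX.aemeasurable (by fun_prop), integral_map hmY.aemeasurable (by fun_prop)]
    rcases Nat.eq_zero_or_pos k with rfl | hk
    · simp
    · have := h k hk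
      simp_rw [← Real.exp_nat_mul]
      simpa using this
  have hlog : ∀ Z : Ω → ℝ, Measurable (fun ω => Real.exp (-Z ω)) → P.map Z =
      (P.map fun ω => Real.exp (-Z ω)).map fun x => -Real.log x := fun Z hZ => by
    rw [Measure.map_map (show Measurable fun x => -Real.log x from Real.measurable_log.neg) hZ]
    congr 1
    funext ω
    simp
  rw [hlog X hmX, hlog Y hmY, hE]

/-! ### The Mittag-Leffler series -/

/-- Restrict the Gamma integral to (M, M+1]. As M is arbitrary, Γ outgrows every exponential. -/
theorem rpow_mul_exp_neg_le_Gamma {x M : ℝ} (hx : 0 ≤ x) (hM : 0 < M) :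
    M ^ x * Real.exp (-(M + 1)) ≤ Real.Gamma (x + 1) := by
  have hint : IntegrableOn (fun t : ℝ => Real.exp (-t) * t ^ (x + 1 - 1)) (Ioi 0) :=
    Real.GammaIntegral_convergent (by linarith)
  rw [Real.Gamma_eq_integral (by linarith)]
  have hsub : Ioc M (M + 1) ⊆ Ioi 0 := fun t ht => hM.trans ht.1
  have h1 : ∫ t in Ioc M (M + 1), Real.exp (-t) * t ^ (x + 1 - 1) ≤
      ∫ t in Ioi 0, Real.exp (-t) * t ^ (x + 1 - 1) := by
    refine setIntegral_mono_set hint ?_ hsub.eventuallyLE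
    filter_upwards [ae_restrict_mem measurableSet_Ioi] with t ht
    have : (0 : ℝ) < t := ht
    simp only [Pi.zero_apply]
    positivity
  refine le_trans ?_ h1
  have h2 : ∫ _ in Ioc M (M + 1), M ^ x * Real.exp (-(M + 1)) = M ^ x * Real.exp (-(M + 1)) := by
    simp
  rw [← h2]
  refine setIntegral_mono_on (integrableOn_const (by simp)) (hint.mono_set hsub)
    measurableSet_Ioc fun t ht => ?_
  rw [add_sub_cancel_right, mul_comm]
  have := ht.1.le
  have := ht.2
  gcongr

theorem summable_pow_div_Gamma {β : ℝ} (hβ : 0 < β) {z : ℝ} (hz : 0 ≤ z) :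
    Summable fun n : ℕ => z ^ n / Real.Gamma (n * β + 1) := by
  -- With this M the n-th term is at most e^(M+1) 2^(-n).
  obtain ⟨M, hM0, hM⟩ : ∃ M : ℝ, 0 < M ∧ M ^ β = 2 * (z + 1) :=
    ⟨(2 * (z + 1)) ^ (1 / β), by positivity, by
      rw [← Real.rpow_mul (by positivity), one_div_mul_cancel hβ.ne', Real.rpow_one]⟩
  have hg : Summable fun n : ℕ => Real.exp (M + 1) * (1 / 2 : ℝ) ^ n :=
    (summable_geometric_of_lt_one (by norm_num) (by norm_num)).mul_left _
  refine Summable.of_nonneg_of_le (fun n => ?_) (fun n => ?_) hg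
  · have : 0 < Real.Gamma (n * β + 1) := Real.Gamma_pos_of_pos (by positivity)
    positivity
  · have h1 := rpow_mul_exp_neg_le_Gamma (x := n * β) (by positivity) hM0
    have h2 : M ^ (n * β) = (2 * (z + 1)) ^ n := by
      rw [mul_comm, Real.rpow_mul hM0.le, hM, Real.rpow_natCast]
    rw [h2] at h1
    calc z ^ n / Real.Gamma (n * β + 1) ≤ z ^ n / ((2 * (z + 1)) ^ n * Real.exp (-(M + 1))) := by
          gcongr
      _ ≤ (z + 1) ^ n / ((2 * (z + 1)) ^ n * Real.exp (-(M + 1))) := by gcongr; linarith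
      _ = _ := by
          rw [Real.exp_neg, mul_pow, one_div, inv_pow]
          field_simp

/-! ### Regular paths of the subordinator -/

theorem IsStableSubordinator.integrable_exp {Ω : Type*} [MeasurableSpace Ω] {P : Measure Ω}
    {β : ℝ} {S : ℝ≥0 → Ω → ℝ} (hS : IsStableSubordinator β S P) (t : ℝ≥0) {θ : ℝ} (hθ : 0 < θ) :
    Integrable (fun ω => Real.exp (-θ * S t ω)) P := by
  by_contra h
  have := hS.laplace t θ hθ
  rw [integral_undef h] at this
  exact (Real.exp_pos _).ne this

theorem IsStableSubordinator.measureReal_le {Ω : Type*} [MeasurableSpace Ω] {P : Measure Ω}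
    [IsProbabilityMeasure P] {β : ℝ} {S : ℝ≥0 → Ω → ℝ} (hS : IsStableSubordinator β S P)
    (t : ℝ≥0) {θ : ℝ} (hθ : 0 < θ) (K : ℝ) :
    P.real {ω | S t ω ≤ K} ≤ Real.exp (θ * K) * Real.exp (-(t : ℝ) * θ ^ β) := by
  have := measure_le_le_exp_mul_mgf K (t := -θ) (by linarith) (hS.integrable_exp t hθ)
  rwa [mgf, hS.laplace t θ hθ, neg_neg] at this

theorem IsStableSubordinator.ae_pos {Ω : Type*} [MeasurableSpace Ω] {P : Measure Ω}
    [IsProbabilityMeasure P] {β : ℝ} (hβ : 0 < β) {S : ℝ≥0 → Ω → ℝ}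
    (hS : IsStableSubordinator β S P) {t : ℝ≥0} (ht : 0 < t) : ∀ᵐ ω ∂P, 0 < S t ω := by
  have h0 : P.real {ω | S t ω ≤ 0} ≤ 0 := by
    have hlim : Tendsto (fun θ : ℝ => Real.exp (-(t : ℝ) * θ ^ β)) atTop (𝓝 0) := by
      have ht' : (0 : ℝ) < t := by exact_mod_cast ht
      refine Real.tendsto_exp_atBot.comp ?_
      exact (tendsto_rpow_atTop hβ).const_mul_atTop_of_neg (by linarith)
    refine ge_of_tendsto hlim ?_
    filter_upwards [eventually_gt_atTop 0] with θ hθ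
    simpa using hS.measureReal_le t hθ 0
  have h1 : P {ω | S t ω ≤ 0} = 0 :=
    (measureReal_eq_zero_iff).1 (le_antisymm h0 measureReal_nonneg)
  filter_upwards [measure_eq_zero_iff_ae_notMem.1 h1] with ω hω
  exact not_le.1 hω

/-- Stationarity reduces positivity of increments between rational times to `ae_pos`; monotonicity
extends it to all times. -/
theorem IsStableSubordinator.ae_strictMono {Ω : Type*} [MeasurableSpace Ω] {P : Measure Ω}
    [IsProbabilityMeasure P] {β : ℝ} (hβ : 0 < β) {S : ℝ≥0 → Ω → ℝ}
    (hS : IsStableSubordinator β S P) : ∀ᵐ ω ∂P, StrictMono fun t => S t ω := by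
  have h : ∀ᵐ ω ∂P, ∀ a b : ℚ, Real.toNNReal a < Real.toNNReal b →
      S (Real.toNNReal a) ω < S (Real.toNNReal b) ω := by
    rw [ae_all_iff]; intro a
    rw [ae_all_iff]; intro b
    by_cases hab : Real.toNNReal a < Real.toNNReal b
    swap
    · exact Eventually.of_forall fun ω h => absurd h hab
    have hid := hS.stationary_increments (Real.toNNReal a) (Real.toNNReal b - Real.toNNReal a)
    rw [add_tsub_cancel_of_le hab.le] at hid
    have hpos := hS.ae_pos hβ (tsub_pos_of_lt hab)
    have := (hid.symm.ae_snd (p := fun x => 0 < x) measurableSet_Ioi hpos)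
    filter_upwards [this] with ω hω _ using sub_pos.1 hω
  filter_upwards [h, hS.monotone_paths] with ω hω hm s t hst
  obtain ⟨a, -, ha1, ha2⟩ := (NNReal.lt_iff_exists_rat_btwn s t).1 hst
  obtain ⟨b, -, hb1, hb2⟩ := (NNReal.lt_iff_exists_rat_btwn _ t).1 ha2
  exact (hm ha1.le).trans_lt ((hω a b hb1).trans_le (hm hb2.le))

theorem IsStableSubordinator.ae_unbounded {Ω : Type*} [MeasurableSpace Ω] {P : Measure Ω}
    [IsProbabilityMeasure P] {β : ℝ} {S : ℝ≥0 → Ω → ℝ}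
    (hS : IsStableSubordinator β S P) : ∀ᵐ ω ∂P, ∀ K : ℝ, ∃ t, K < S t ω := by
  have h : ∀ᵐ ω ∂P, ∀ K : ℕ, ∃ t, (K : ℝ) < S t ω := by
    rw [ae_all_iff]; intro K
    have h0 : P.real {ω | ∀ t, S t ω ≤ K} ≤ 0 := by
      have hlim : Tendsto (fun n : ℕ => Real.exp (1 * K) * Real.exp (-(n : ℝ) * 1 ^ β)) atTop
          (𝓝 (Real.exp (1 * K) * 0)) := by
        refine Tendsto.const_mul _ (Real.tendsto_exp_atBot.comp ?_)
        simpa using tendsto_natCast_atTop_atTop (R := ℝ)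
      rw [mul_zero] at hlim
      refine ge_of_tendsto' hlim fun n => ?_
      refine le_trans (measureReal_mono fun ω hω => hω n) ?_
      have := hS.measureReal_le n one_pos K
      rwa [NNReal.coe_natCast] at this
    have h1 : P {ω | ∀ t, S t ω ≤ K} = 0 :=
      (measureReal_eq_zero_iff).1 (le_antisymm h0 measureReal_nonneg)
    filter_upwards [measure_eq_zero_iff_ae_notMem.1 h1] with ω hω
    by_contra! hcon
    exact hω hcon
  filter_upwards [h] with ω hω K
  obtain ⟨n, hn⟩ := exists_nat_gt K
  obtain ⟨t, ht⟩ := hω n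
  exact ⟨t, hn.trans ht⟩

/-- A path that starts at zero, increases strictly to infinity and is right-continuous. -/
structure IsRegularPath (s : ℝ≥0 → ℝ) : Prop where
  zero : s 0 = 0
  strictMono : StrictMono s
  rightContinuous : ∀ t, ContinuousWithinAt s (Ici t) t
  unbounded : ∀ K : ℝ, ∃ t, K < s t

theorem isRegularPath_coe : IsRegularPath fun t : ℝ≥0 => (t : ℝ) where
  zero := rfl
  strictMono := fun _ _ h => NNReal.coe_lt_coe.2 h
  rightContinuous _ := NNReal.continuous_coe.continuousWithinAt
  unbounded K := by
    obtain ⟨n, hn⟩ := exists_nat_gt K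
    exact ⟨n, by simpa using hn⟩

theorem IsStableSubordinator.exists_regular {Ω : Type*} [MeasurableSpace Ω] {P : Measure Ω}
    [IsProbabilityMeasure P] {β : ℝ} (hβ : 0 < β) {S : ℝ≥0 → Ω → ℝ}
    (hS : IsStableSubordinator β S P) :
    ∃ S' : ℝ≥0 → Ω → ℝ, (∀ t, Measurable (S' t)) ∧ (∀ ω, IsRegularPath fun t => S' t ω) ∧
      ∀ᵐ ω ∂P, ∀ t, S' t ω = S t ω := by
  classical
  have hgood : ∀ᵐ ω ∂P, IsRegularPath fun t => S t ω := by
    filter_upwards [hS.zero, hS.ae_strictMono hβ, hS.rightContinuous_paths, hS.ae_unbounded]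
      with ω h1 h2 h3 h4 using ⟨h1, h2, h3, h4⟩
  obtain ⟨N, hN, hNm, hN0⟩ := exists_measurable_superset_of_null hgood
  have hG : ∀ ω ∉ N, IsRegularPath fun t => S t ω := fun ω hω => by
    by_contra hcon
    exact hω (hN hcon)
  refine ⟨fun t ω => if ω ∈ N then (t : ℝ) else S t ω,
    fun t => Measurable.ite hNm measurable_const (hS.measurable t), fun ω => ?_, ?_⟩
  · by_cases hω : ω ∈ N
    · simpa [hω] using isRegularPath_coe
    · simpa [hω] using hG ω hω
  · filter_upwards [measure_eq_zero_iff_ae_notMem.1 hN0] with ω hω t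
    simp [hω]

section Inverse

variable {Ω : Type*} {S : ℝ≥0 → Ω → ℝ} {ω : Ω}

theorem inverseProcess_nonempty (h : IsRegularPath fun t => S t ω) (t : ℝ≥0) :
    {s : ℝ≥0 | (t : ℝ) < S s ω}.Nonempty := h.unbounded t

theorem apply_le_of_lt_inverseProcess {t s : ℝ≥0} (hs : s < inverseProcess S t ω) :
    S s ω ≤ t := by
  have := notMem_of_lt_csInf hs (OrderBot.bddBelow _)
  exact not_lt.1 this

theorem le_inverseProcess (h : IsRegularPath fun t => S t ω) {t s : ℝ≥0} (hs : S s ω ≤ t) :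
    s ≤ inverseProcess S t ω :=
  le_csInf (inverseProcess_nonempty h t) fun _ hx =>
    (h.strictMono.lt_iff_lt.1 (hs.trans_lt hx)).le

theorem inverseProcess_le {t s : ℝ≥0} (hs : (t : ℝ) < S s ω) : inverseProcess S t ω ≤ s :=
  csInf_le (OrderBot.bddBelow _) hs

theorem monotone_inverseProcess (h : IsRegularPath fun t => S t ω) :
    Monotone fun t => inverseProcess S t ω := fun _ b hab =>
  csInf_le_csInf (OrderBot.bddBelow _) (inverseProcess_nonempty h b) fun _ hx =>
    lt_of_le_of_lt (NNReal.coe_le_coe.2 hab) (show (b : ℝ) < _ from hx)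

theorem inverseProcess_apply (h : IsRegularPath fun t => S t ω) (s : ℝ≥0) :
    inverseProcess S (S s ω).toNNReal ω = s := by
  have h0 : 0 ≤ S s ω := h.zero.symm.le.trans (h.strictMono.monotone zero_le)
  refine le_antisymm (le_of_forall_gt_imp_ge_of_dense fun x hx => inverseProcess_le ?_)
    (le_inverseProcess h ?_)
  · rw [Real.coe_toNNReal _ h0]; exact h.strictMono hx
  · rw [Real.coe_toNNReal _ h0]

/-- A monotone surjection is continuous; the value s is attained at time S(s) because S is strictly
increasing. -/
theorem continuous_inverseProcess (h : IsRegularPath fun t => S t ω) :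
    Continuous fun t => inverseProcess S t ω :=
  (monotone_inverseProcess h).continuous_of_surjective fun s => ⟨_, inverseProcess_apply h s⟩

theorem inverseProcess_zero (h : IsRegularPath fun t => S t ω) : inverseProcess S 0 ω = 0 := by
  have := inverseProcess_apply h 0
  rwa [h.zero, Real.toNNReal_zero] at this

theorem inverseProcess_pos (h : IsRegularPath fun t => S t ω) {t : ℝ≥0} (ht : 0 < t) :
    0 < inverseProcess S t ω := by
  have hc : Tendsto (fun s => S s ω) (𝓝[>] 0) (𝓝 (S 0 ω)) :=
    (h.rightContinuous 0).mono Ioi_subset_Ici_self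
  have hlt : S 0 ω < t := by rw [h.zero]; exact_mod_cast ht
  obtain ⟨s, hs, hs0⟩ := ((hc.eventually (gt_mem_nhds hlt)).and self_mem_nhdsWithin).exists
  exact lt_of_lt_of_le hs0 (le_inverseProcess h hs.le)

theorem measurable_inverseProcess_apply [MeasurableSpace Ω] (hm : ∀ t, Measurable (S t))
    (h : ∀ ω, IsRegularPath fun t => S t ω) (t : ℝ≥0) : Measurable (inverseProcess S t) := by
  refine measurable_of_Iio fun c => ?_
  have e : inverseProcess S t ⁻¹' Iio c =
      ⋃ (q : ℚ) (_ : Real.toNNReal q < c), {ω | (t : ℝ) < S (Real.toNNReal q) ω} := by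
    ext ω
    simp only [mem_preimage, mem_Iio, mem_iUnion, mem_ofPred_eq, exists_prop]
    constructor
    · intro hlt
      obtain ⟨q, -, hq1, hq2⟩ := (NNReal.lt_iff_exists_rat_btwn _ _).1 hlt
      obtain ⟨x, hx, hxq⟩ := exists_lt_of_csInf_lt (inverseProcess_nonempty (h ω) t) hq1
      exact ⟨q, hq2, lt_of_lt_of_le hx ((h ω).strictMono.monotone hxq.le)⟩
    · rintro ⟨q, hq, hlt⟩
      exact (inverseProcess_le hlt).trans_lt hq
  rw [e]
  exact MeasurableSet.iUnion fun q => MeasurableSet.iUnion fun _ =>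
    measurableSet_lt measurable_const (hm _)

end Inverse

/-! ### The law of the inverse process -/

/-- Self-similarity of the stable subordinator, read off the Laplace transform. -/
theorem map_eq_map_rpow_mul {Ω : Type*} [MeasurableSpace Ω] {P : Measure Ω}
    [IsProbabilityMeasure P] {β : ℝ} (hβ : 0 < β) {S : ℝ≥0 → Ω → ℝ} (hm : ∀ t, Measurable (S t))
    (h0 : ∀ t ω, 0 ≤ S t ω) (hL : ∀ (t : ℝ≥0) (θ : ℝ), 0 < θ →
      ∫ ω, Real.exp (-θ * S t ω) ∂P = Real.exp (-(t : ℝ) * θ ^ β)) {s : ℝ≥0} (hs : 0 < s) :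
    P.map (S s) = P.map fun ω => (s : ℝ) ^ (1 / β) * S 1 ω := by
  have hs' : (0 : ℝ) < s := by exact_mod_cast hs
  refine map_eq_of_laplace_eq (hm s) ((hm 1).const_mul _) (h0 s)
    (fun ω => mul_nonneg (by positivity) (h0 1 ω)) fun k hk => ?_
  have hk' : (0 : ℝ) < k := by exact_mod_cast hk
  rw [hL s k hk']
  have h2 := hL 1 (k * (s : ℝ) ^ (1 / β)) (by positivity)
  have e : ∀ ω, -(k : ℝ) * ((s : ℝ) ^ (1 / β) * S 1 ω) = -(k * (s : ℝ) ^ (1 / β)) * S 1 ω :=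
    fun ω => by ring
  simp_rw [e]
  rw [h2, Real.mul_rpow hk'.le (by positivity), ← Real.rpow_mul hs'.le, one_div_mul_cancel hβ.ne',
    Real.rpow_one]
  congr 1
  push_cast
  ring

/-- Write Γ(q) x^(-q) as ∫ θ^(q-1) e^(-xθ) dθ, exchange the integrals, and insert the Laplace
transform. -/
theorem lintegral_rpow_neg {Ω : Type*} [MeasurableSpace Ω] {P : Measure Ω}
    [IsProbabilityMeasure P] {β : ℝ} (hβ : 0 < β) {X : Ω → ℝ} (hm : Measurable X)
    (h0 : ∀ ω, 0 < X ω) (hL : ∀ θ : ℝ, 0 < θ →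
      ∫ ω, Real.exp (-θ * X ω) ∂P = Real.exp (-θ ^ β)) {q : ℝ} (hq : 0 < q) :
    ∫⁻ ω, ENNReal.ofReal (X ω ^ (-q)) ∂P =
      ENNReal.ofReal (Real.Gamma (q / β) / (β * Real.Gamma q)) := by
  have hG : 0 < Real.Gamma q := Real.Gamma_pos_of_pos hq
  have hG' : 0 < Real.Gamma (q / β) := Real.Gamma_pos_of_pos (by positivity)
  have h1 : ∀ ω, ENNReal.ofReal (X ω ^ (-q)) * ENNReal.ofReal (Real.Gamma q) =
      ∫⁻ θ in Ioi (0 : ℝ), ENNReal.ofReal (θ ^ (q - 1) * Real.exp (-(X ω * θ))) := by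
    intro ω
    have hi := Real.integral_rpow_mul_exp_neg_mul_Ioi hq (h0 ω)
    have hpos : (1 / X ω) ^ q * Real.Gamma q ≠ 0 := by have := h0 ω; positivity
    rw [← ofReal_integral_eq_lintegral_ofReal, hi,
      ← ENNReal.ofReal_mul (by have := h0 ω; positivity),
      Real.rpow_neg (h0 ω).le, one_div, Real.inv_rpow (h0 ω).le]
    · by_contra hcon
      exact hpos (hi.symm.trans (integral_undef hcon))
    · filter_upwards [ae_restrict_mem measurableSet_Ioi] with θ hθ
      have : (0 : ℝ) < θ := hθ
      simp only [Pi.zero_apply]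
      positivity
  have h2 : ∀ θ ∈ Ioi (0 : ℝ), ∫⁻ ω, ENNReal.ofReal (θ ^ (q - 1) * Real.exp (-(X ω * θ))) ∂P =
      ENNReal.ofReal (θ ^ (q - 1) * Real.exp (-θ ^ β)) := by
    intro θ hθ
    have hθ' : (0 : ℝ) < θ := hθ
    have hint : Integrable (fun ω => Real.exp (-θ * X ω)) P := by
      by_contra hcon
      have := hL θ hθ'
      rw [integral_undef hcon] at this
      exact (Real.exp_pos _).ne this
    have e : ∀ ω, θ ^ (q - 1) * Real.exp (-(X ω * θ)) = θ ^ (q - 1) * Real.exp (-θ * X ω) :=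
      fun ω => by congr 2; ring
    simp_rw [e]
    rw [← ofReal_integral_eq_lintegral_ofReal (hint.const_mul _)
      (Eventually.of_forall fun ω => by simp only [Pi.zero_apply]; positivity),
      integral_const_mul, hL θ hθ']
  have h3 : (∫⁻ ω, ENNReal.ofReal (X ω ^ (-q)) ∂P) * ENNReal.ofReal (Real.Gamma q) =
      ENNReal.ofReal (1 / β * Real.Gamma (q / β)) := by
    rw [← lintegral_mul_const _ (by fun_prop)]
    simp_rw [h1]
    rw [lintegral_lintegral_swap (by fun_prop), setLIntegral_congr_fun measurableSet_Ioi h2]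
    have hi := integral_rpow_mul_exp_neg_rpow hβ (q := q - 1) (by linarith)
    rw [sub_add_cancel] at hi
    rw [← hi, ofReal_integral_eq_lintegral_ofReal]
    · by_contra hcon
      have := hi.symm.trans (integral_undef hcon)
      exact (by positivity : (1 / β * Real.Gamma (q / β)) ≠ 0) this
    · filter_upwards [ae_restrict_mem measurableSet_Ioi] with θ hθ
      have : (0 : ℝ) < θ := hθ
      simp only [Pi.zero_apply]
      positivity
  rw [ENNReal.eq_div_iff (by simpa using hG) ENNReal.ofReal_ne_top |>.2
    ((mul_comm _ _).trans h3), ← ENNReal.ofReal_div_of_pos hG]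
  congr 1
  field_simp

theorem lintegral_inverseProcess_pow {Ω : Type*} [MeasurableSpace Ω] {P : Measure Ω}
    [IsProbabilityMeasure P] {β : ℝ} (hβ : 0 < β) {S : ℝ≥0 → Ω → ℝ} (hm : ∀ t, Measurable (S t))
    (hreg : ∀ ω, IsRegularPath fun t => S t ω) (hL : ∀ (t : ℝ≥0) (θ : ℝ), 0 < θ →
      ∫ ω, Real.exp (-θ * S t ω) ∂P = Real.exp (-(t : ℝ) * θ ^ β)) (t : ℝ≥0) (n : ℕ) :
    ∫⁻ ω, ENNReal.ofReal ((inverseProcess S t ω : ℝ) ^ n) ∂P =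
      ENNReal.ofReal (((t : ℝ) ^ β) ^ n * n.factorial / Real.Gamma (n * β + 1)) := by
  rcases Nat.eq_zero_or_pos n with rfl | hn
  · simp
  have hn' : (0 : ℝ) < n := by exact_mod_cast hn
  have h0 : ∀ t ω, 0 ≤ S t ω := fun t ω =>
    (hreg ω).zero.symm.le.trans ((hreg ω).strictMono.monotone zero_le)
  have h1 : ∀ ω, 0 < S 1 ω := fun ω =>
    (hreg ω).zero.symm.le.trans_lt ((hreg ω).strictMono one_pos)
  let U : Ω → ℝ := fun ω => inverseProcess S t ω
  have hU : Measurable U := (measurable_inverseProcess_apply hm hreg t).coe_nnreal_real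
  let V : Ω → ℝ := fun ω => (t / S 1 ω) ^ β
  have hV : Measurable V := (measurable_const.div (hm 1)).pow_const β
  have hVS : ∀ s ∈ Ioi (0 : ℝ), P {ω | s ≤ V ω} = P {ω | S s.toNNReal ω ≤ t} := by
    intro s hs
    have hs' : (0 : ℝ) < s := hs
    have hmap := map_eq_map_rpow_mul hβ hm h0 hL (s := s.toNNReal) (Real.toNNReal_pos.2 hs')
    have e1 := Measure.map_apply (μ := P) (hm s.toNNReal) (measurableSet_Iic (a := (t : ℝ)))
    have e2 := Measure.map_apply (μ := P) ((hm 1).const_mul ((s.toNNReal : ℝ) ^ (1 / β)))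
      (measurableSet_Iic (a := (t : ℝ)))
    change _ = P (S s.toNNReal ⁻¹' Iic (t : ℝ))
    rw [← e1, hmap, e2]
    congr 1
    ext ω
    simp only [mem_ofPred_eq, mem_preimage, mem_Iic, V, Real.coe_toNNReal s hs'.le]
    rw [← le_div_iff₀ (h1 ω), one_div, Real.rpow_inv_le_iff_of_pos hs'.le
      (div_nonneg t.coe_nonneg (h1 ω).le) hβ]
  -- Since {s < U} ⊆ {S(s) ≤ t} ⊆ {s ≤ U}, the layer-cake formulas with strict and weak inequality
  -- bound the moments of U by those of V from both sides.
  have e1 := lintegral_rpow_eq_lintegral_meas_lt_mul P (f := U)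
    (Eventually.of_forall fun ω => NNReal.coe_nonneg _) hU.aemeasurable hn'
  have e2 := lintegral_rpow_eq_lintegral_meas_le_mul P (f := U)
    (Eventually.of_forall fun ω => NNReal.coe_nonneg _) hU.aemeasurable hn'
  have e3 := lintegral_rpow_eq_lintegral_meas_le_mul P (f := V)
    (Eventually.of_forall fun ω => Real.rpow_nonneg (div_nonneg t.coe_nonneg (h1 ω).le) _)
    hV.aemeasurable hn'
  have hUV : ∫⁻ ω, ENNReal.ofReal (U ω ^ (n : ℝ)) ∂P = ∫⁻ ω, ENNReal.ofReal (V ω ^ (n : ℝ)) ∂P := by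
    refine le_antisymm ?_ ?_
    · rw [e1, e3]
      gcongr ENNReal.ofReal (n : ℝ) * ?_
      refine setLIntegral_mono' measurableSet_Ioi fun s hs => ?_
      rw [hVS s hs]
      gcongr ?_ * _
      refine measure_mono fun ω hω => apply_le_of_lt_inverseProcess ?_
      exact (Real.toNNReal_lt_iff_lt_coe (le_of_lt hs)).2 hω
    · rw [e2, e3]
      gcongr ENNReal.ofReal (n : ℝ) * ?_
      refine setLIntegral_mono' measurableSet_Ioi fun s hs => ?_
      rw [hVS s hs]
      gcongr ?_ * _
      refine measure_mono fun ω hω => ?_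
      exact Real.toNNReal_le_iff_le_coe.1 (le_inverseProcess (hreg ω) hω)
  simp only [U, Real.rpow_natCast] at hUV
  rw [hUV]
  have hV' : ∀ ω, ENNReal.ofReal (V ω ^ n) =
      ENNReal.ofReal (((t : ℝ) ^ β) ^ n) * ENNReal.ofReal (S 1 ω ^ (-(n * β))) := by
    intro ω
    rw [← ENNReal.ofReal_mul (by positivity)]
    congr 1
    simp only [V]
    rw [Real.div_rpow t.coe_nonneg (h1 ω).le, div_pow, Real.rpow_neg (h1 ω).le, mul_comm (n : ℝ),
      Real.rpow_mul (h1 ω).le, Real.rpow_natCast, div_eq_mul_inv]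
  simp_rw [hV']
  have hmS := hm 1
  rw [lintegral_const_mul _ (by fun_prop), lintegral_rpow_neg hβ hmS h1
    (fun θ hθ => by simpa using hL 1 θ hθ) (by positivity), ← ENNReal.ofReal_mul (by positivity)]
  congr 1
  rw [mul_div_cancel_right₀ _ hβ.ne', Real.Gamma_add_one (by positivity), mul_div_assoc]
  congr 1
  obtain ⟨m, rfl⟩ : ∃ m, n = m + 1 := ⟨n - 1, by omega⟩
  have hG : 0 < Real.Gamma (((m + 1 : ℕ) : ℝ) * β) := Real.Gamma_pos_of_pos (by positivity)
  have : Real.Gamma ((m + 1 : ℕ) : ℝ) = m.factorial := by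
    push_cast; exact Real.Gamma_nat_eq_factorial m
  rw [this, Nat.factorial_succ]
  push_cast at hG ⊢
  field_simp

theorem integral_exp_mul_inverseProcess {Ω : Type*} [MeasurableSpace Ω] {P : Measure Ω}
    [IsProbabilityMeasure P] {β : ℝ} (hβ : 0 < β) {S : ℝ≥0 → Ω → ℝ} (hm : ∀ t, Measurable (S t))
    (hreg : ∀ ω, IsRegularPath fun t => S t ω) (hL : ∀ (t : ℝ≥0) (θ : ℝ), 0 < θ →
      ∫ ω, Real.exp (-θ * S t ω) ∂P = Real.exp (-(t : ℝ) * θ ^ β)) (t : ℝ≥0) (z : ℂ) :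
    ∫ ω, Complex.exp (z * (inverseProcess S t ω : ℝ)) ∂P =
      mittagLeffler β (z * ((t : ℝ) ^ β : ℝ)) := by
  let U : Ω → ℝ := fun ω => inverseProcess S t ω
  have hU : Measurable U := (measurable_inverseProcess_apply hm hreg t).coe_nnreal_real
  have hU0 : ∀ ω, 0 ≤ U ω := fun ω => NNReal.coe_nonneg _
  let c : ℕ → ℝ := fun n => ((t : ℝ) ^ β) ^ n * n.factorial / Real.Gamma (n * β + 1)
  have hGpos : ∀ n : ℕ, 0 < Real.Gamma (n * β + 1) := fun n =>
    Real.Gamma_pos_of_pos (by positivity)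
  have hc : ∀ n, 0 ≤ c n := fun n => by have := hGpos n; positivity
  have hmom : ∀ n, ∫⁻ ω, ENNReal.ofReal (U ω ^ n) ∂P = ENNReal.ofReal (c n) := fun n =>
    lintegral_inverseProcess_pow hβ hm hreg hL t n
  have hUint : ∀ n, Integrable (fun ω => U ω ^ n) P := fun n =>
    (lintegral_ofReal_ne_top_iff_integrable (hU.pow_const n).aestronglyMeasurable
      (Eventually.of_forall fun ω => pow_nonneg (hU0 ω) n)).1
      (by rw [hmom]; exact ENNReal.ofReal_ne_top)
  have hUmom : ∀ n, ∫ ω, U ω ^ n ∂P = c n := fun n => by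
    rw [integral_eq_lintegral_of_nonneg_ae (Eventually.of_forall fun ω => pow_nonneg (hU0 ω) n)
      (hU.pow_const n).aestronglyMeasurable, hmom, ENNReal.toReal_ofReal (hc n)]
  let F : ℕ → Ω → ℂ := fun n ω => z ^ n / n.factorial * ((U ω ^ n : ℝ) : ℂ)
  have hF : ∀ n, Integrable (F n) P := fun n => ((hUint n).ofReal).const_mul _
  have hnorm : ∀ n, ∫ ω, ‖F n ω‖ ∂P = (‖z‖ * (t : ℝ) ^ β) ^ n / Real.Gamma (n * β + 1) := by
    intro n
    have e : ∀ ω, ‖F n ω‖ = ‖z‖ ^ n / n.factorial * U ω ^ n := fun ω => by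
      simp only [F, norm_mul, norm_div, norm_pow, Complex.norm_natCast, Complex.norm_real,
        Real.norm_eq_abs, abs_of_nonneg (hU0 ω)]
    simp_rw [e]
    rw [integral_const_mul, hUmom]
    simp only [c]
    have := n.factorial_ne_zero
    rw [mul_pow]
    field_simp
  have hsum : Summable fun n => ∫ ω, ‖F n ω‖ ∂P := by
    simp_rw [hnorm]
    exact summable_pow_div_Gamma hβ (by positivity)
  have h1 := (hasSum_integral_of_summable_integral_norm hF hsum).tsum_eq
  have h2 : ∀ ω, Complex.exp (z * (inverseProcess S t ω : ℝ)) = ∑' n, F n ω := fun ω => by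
    rw [Complex.exp_eq_exp_ℂ, NormedSpace.exp_eq_tsum_div]
    refine tsum_congr fun n => ?_
    simp only [F, U]
    push_cast
    ring
  simp_rw [h2]
  rw [← h1, mittagLeffler]
  refine tsum_congr fun n => ?_
  simp only [F]
  rw [integral_const_mul, integral_complex_ofReal, hUmom]
  have e : Complex.Gamma (β * n + 1) = (Real.Gamma (n * β + 1) : ℝ) := by
    rw [← Complex.Gamma_ofReal]; push_cast; ring_nf
  rw [e]
  simp only [c]
  have hf : (n.factorial : ℂ) ≠ 0 := by exact_mod_cast n.factorial_ne_zero
  have hg : ((Real.Gamma (n * β + 1) : ℝ) : ℂ) ≠ 0 := by exact_mod_cast (hGpos n).ne'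
  rw [mul_pow]
  push_cast
  field_simp

/-! ### A continuous process evaluated at an independent random time -/

/-- Evaluation (w, u) ↦ w(u) is replaced by the limsup of w along dyadic floors of u. This is
measurable for the product σ-algebra and agrees with evaluation on continuous paths, so independence
can be pushed forward. -/
theorem map_eval_eq_map_prod {Ω : Type*} [MeasurableSpace Ω] {P : Measure Ω}
    [IsProbabilityMeasure P] {W : ℝ≥0 → Ω → ℝ} (hWm : ∀ t, Measurable (W t))
    (hWc : ∀ ω, Continuous fun t => W t ω) {U : Ω → ℝ≥0} (hU : Measurable U)
    (hind : IndepFun (fun ω t => W t ω) U P) :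
    P.map (fun ω => W (U ω) ω) = (P.prod P).map fun z => W (U z.2) z.1 := by
  let F : (ℝ≥0 → ℝ) × ℝ≥0 → ℝ := fun z => limsup (fun n => z.1 (dyadicFloor n z.2)) atTop
  have hF : Measurable F := by
    refine Measurable.limsup fun n => ?_
    have h1 : Measurable fun z : (ℝ≥0 → ℝ) × ℕ => z.1 (z.2 / 2 ^ n) :=
      measurable_from_prod_countable_left fun k => measurable_pi_apply (k / 2 ^ n : ℝ≥0)
    have h2 : Measurable fun z : (ℝ≥0 → ℝ) × ℝ≥0 => (z.1, ⌊2 ^ n * z.2⌋₊) :=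
      measurable_fst.prodMk (Nat.measurable_floor.comp (measurable_const.mul measurable_snd))
    exact h1.comp h2
  have hFW : ∀ ω u, F ((fun t => W t ω), u) = W u ω := fun ω u =>
    (((hWc ω).tendsto u).comp (tendsto_dyadicFloor u)).limsup_eq
  have hW : Measurable fun ω t => W t ω := measurable_pi_lambda _ hWm
  have hprod := hind.map_prod_eq_prod_map_map hW.aemeasurable hU.aemeasurable
  rw [Measure.map_prod_map _ _ hW hU] at hprod
  have h := congrArg (fun μ => Measure.map F μ) hprod
  rw [Measure.map_map hF (hW.prodMk hU), Measure.map_map hF (hW.prodMap hU)] at h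
  have e1 : F ∘ (fun ω => ((fun t => W t ω), U ω)) = fun ω => W (U ω) ω :=
    funext fun ω => hFW ω _
  have e2 : F ∘ Prod.map (fun ω t => W t ω) U = fun z => W (U z.2) z.1 :=
    funext fun z => hFW z.1 _
  rwa [e1, e2] at h

theorem lintegral_map_eval {Ω : Type*} [MeasurableSpace Ω] {P : Measure Ω}
    [IsProbabilityMeasure P] {W : ℝ≥0 → Ω → ℝ} (hWm : ∀ t, Measurable (W t))
    (hWc : ∀ ω, Continuous fun t => W t ω) (hWg : ∀ t, P.map (W t) = gaussianReal 0 t)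
    {U : Ω → ℝ≥0} (hU : Measurable U) (hind : IndepFun (fun ω t => W t ω) U P)
    {g : ℝ → ℝ≥0∞} (hg : Measurable g) :
    ∫⁻ x, g x ∂(P.map fun ω => W (U ω) ω) = ∫⁻ ω, ∫⁻ x, g x ∂gaussianReal 0 (U ω) ∂P := by
  have hjm : Measurable fun z : Ω × Ω => W (U z.2) z.1 :=
    (measurable_uncurry_of_continuous_of_measurable hWc hWm).comp
      ((hU.comp measurable_snd).prodMk measurable_fst)
  have hgm : Measurable fun z : Ω × Ω => g (W (U z.2) z.1) := hg.comp hjm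
  rw [map_eval_eq_map_prod hWm hWc hU hind, lintegral_map hg hjm, lintegral_prod_symm' _ hgm]
  refine lintegral_congr fun ω => ?_
  rw [← hWg, lintegral_map hg (hWm _)]

theorem charFun_map_eval {Ω : Type*} [MeasurableSpace Ω] {P : Measure Ω}
    [IsProbabilityMeasure P] {W : ℝ≥0 → Ω → ℝ} (hWm : ∀ t, Measurable (W t))
    (hWc : ∀ ω, Continuous fun t => W t ω) (hWg : ∀ t, P.map (W t) = gaussianReal 0 t)
    {U : Ω → ℝ≥0} (hU : Measurable U) (hind : IndepFun (fun ω t => W t ω) U P) (θ : ℝ) :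
    charFun (P.map fun ω => W (U ω) ω) θ =
      ∫ ω, Complex.exp ((-(1 / 2) * θ ^ 2 : ℝ) * ((U ω : ℝ) : ℂ)) ∂P := by
  have hjm : Measurable fun z : Ω × Ω => W (U z.2) z.1 :=
    (measurable_uncurry_of_continuous_of_measurable hWc hWm).comp
      ((hU.comp measurable_snd).prodMk measurable_fst)
  have hfc : Continuous fun x : ℝ => Complex.exp (θ * x * Complex.I) := by fun_prop
  have hint : Integrable (fun z : Ω × Ω => Complex.exp (θ * (W (U z.2) z.1) * Complex.I))
      (P.prod P) := by
    refine (integrable_const (1 : ℝ)).mono' (hfc.measurable.comp hjm).aestronglyMeasurable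
      (Eventually.of_forall fun z => ?_)
    have := Complex.norm_exp_ofReal_mul_I (θ * W (U z.2) z.1)
    push_cast at this
    exact this.le
  rw [charFun_apply_real, map_eval_eq_map_prod hWm hWc hU hind,
    integral_map hjm.aemeasurable hfc.aestronglyMeasurable, integral_prod_symm _ hint]
  refine integral_congr_ae (Eventually.of_forall fun ω => ?_)
  have h1 := charFun_gaussianReal (μ := 0) (v := U ω) θ
  rw [← hWg, charFun_apply_real, integral_map (hWm _).aemeasurable hfc.aestronglyMeasurable] at h1
  simp only
  rw [h1]
  congr 1
  push_cast
  ring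

/-! ### Gaussian moments -/

theorem gaussianReal_eq_map_sqrt (v : ℝ≥0) :
    gaussianReal 0 v = (gaussianReal 0 1).map fun x => (v : ℝ) ^ (1 / 2 : ℝ) * x := by
  rw [gaussianReal_map_const_mul, mul_zero, mul_one]
  congr 1
  ext
  simp only [NNReal.coe_mk]
  rw [← Real.rpow_natCast, ← Real.rpow_mul v.coe_nonneg]
  norm_num

theorem lintegral_even_pow_gaussianReal_ne_top (m : ℕ) :
    ∫⁻ x, ENNReal.ofReal (x ^ (2 * m)) ∂gaussianReal 0 1 ≠ ∞ := by
  have h := (memLp_id_gaussianReal' (μ := 0) (v := 1) ((2 * m : ℕ) : ℝ≥0∞)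
    (ENNReal.natCast_ne_top _)).integrable_norm_pow'
  simp only [id_eq, Real.norm_eq_abs, pow_mul, sq_abs] at h
  simp_rw [pow_mul]
  exact (lintegral_ofReal_ne_top_iff_integrable (by fun_prop)
    (Eventually.of_forall fun x => by positivity)).2 h

theorem lintegral_even_pow_gaussianReal (v : ℝ≥0) (m : ℕ) :
    ∫⁻ x, ENNReal.ofReal (x ^ (2 * m)) ∂gaussianReal 0 v =
      ENNReal.ofReal ((v : ℝ) ^ m) * ∫⁻ x, ENNReal.ofReal (x ^ (2 * m)) ∂gaussianReal 0 1 := by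
  rw [gaussianReal_eq_map_sqrt, lintegral_map (by fun_prop) (by fun_prop),
    ← lintegral_const_mul _ (by fun_prop)]
  refine lintegral_congr fun x => ?_
  rw [← ENNReal.ofReal_mul (by positivity), mul_pow, pow_mul ((v : ℝ) ^ (1 / 2 : ℝ)),
    ← Real.rpow_natCast _ 2, ← Real.rpow_mul v.coe_nonneg]
  norm_num

theorem hasScalingIncrements_of_isPreBrownianReal {Ω : Type*} [MeasurableSpace Ω] {P : Measure Ω}
    {W : ℝ≥0 → Ω → ℝ} (hW : IsPreBrownianReal W P) :
    HasScalingIncrements W (1 / 2) (gaussianReal 0 1) P := by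
  intro s t hst
  have h := (hW.hasLaw_sub t s).map_eq
  have e : (nndist (t : ℝ) s : ℝ≥0) = t - s := by
    ext
    rw [coe_nndist, Real.dist_eq, NNReal.coe_sub hst,
      abs_of_nonneg (sub_nonneg.2 (by exact_mod_cast hst))]
  have e' : W t - W s = fun ω => W t ω - W s ω := rfl
  rw [← e', ← NNReal.coe_sub hst, ← gaussianReal_eq_map_sqrt, h]
  congr 1

/-! ### Increments of generalized grey Brownian motion -/

theorem IsGGBm.charFun_eval {Ω : Type*} [MeasurableSpace Ω] {P : Measure Ω} {β α : ℝ}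
    (hα : α ≠ 0) {B : ℝ≥0 → Ω → ℝ} (hB : IsGGBm β α B P) (t : ℝ≥0) (θ : ℝ) :
    charFun (P.map (B t)) θ = mittagLeffler β ((-(1 / 2) * θ ^ 2 * (t : ℝ) ^ α : ℝ) : ℂ) := by
  have hfc : Continuous fun x : ℝ => Complex.exp (θ * x * Complex.I) := by fun_prop
  rw [charFun_apply_real, integral_map (hB.measurable t).aemeasurable hfc.aestronglyMeasurable]
  have h := hB.charFun_eq 1 (fun _ => t) (Subsingleton.strictMono _) fun _ => θ
  simp only [Finset.univ_unique, Finset.sum_singleton] at h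
  convert h using 2
  · funext ω
    congr 1
    push_cast
    ring
  · congr 1
    simp only [fbmCov, sub_self, abs_zero, Real.zero_rpow hα]
    ring

theorem mittagLeffler_zero (β : ℝ) : mittagLeffler β 0 = 1 := by
  rw [mittagLeffler, tsum_eq_single 0 fun n hn => by rw [zero_pow hn, zero_div]]
  simp

theorem IsGGBm.charFun_sub {Ω : Type*} [MeasurableSpace Ω] {P : Measure Ω}
    [IsProbabilityMeasure P] {β α : ℝ} (hα : α ≠ 0) {B : ℝ≥0 → Ω → ℝ} (hB : IsGGBm β α B P)
    {s t : ℝ≥0} (hst : s ≤ t) (θ : ℝ) :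
    charFun (P.map fun ω => B t ω - B s ω) θ =
      mittagLeffler β ((-(1 / 2) * θ ^ 2 * ((t : ℝ) - s) ^ α : ℝ) : ℂ) := by
  rcases hst.eq_or_lt with rfl | hlt
  · simp [Real.zero_rpow hα, mittagLeffler_zero]
  have hfc : Continuous fun x : ℝ => Complex.exp (θ * x * Complex.I) := by fun_prop
  have hsub : Measurable fun ω => B t ω - B s ω := (hB.measurable t).sub (hB.measurable s)
  rw [charFun_apply_real, integral_map hsub.aemeasurable hfc.aestronglyMeasurable]
  have hmono : StrictMono ![s, t] := by
    intro i j hij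
    fin_cases i <;> fin_cases j <;> simp_all
  -- With these weights the quadratic form of the covariance collapses to θ² (t - s)^α.
  have h := hB.charFun_eq 2 ![s, t] hmono ![-θ, θ]
  simp only [Fin.sum_univ_two, Matrix.cons_val_zero, Matrix.cons_val_one] at h
  convert h using 2
  · funext ω
    congr 1
    push_cast
    ring
  · congr 1
    simp only [fbmCov, sub_self, abs_zero, Real.zero_rpow hα]
    rw [abs_sub_comm (s : ℝ) t, abs_of_nonneg (sub_nonneg.2 (by exact_mod_cast hst))]
    ring

theorem IsGGBm.hasScalingIncrements {Ω : Type*} [MeasurableSpace Ω] {P : Measure Ω}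
    [IsProbabilityMeasure P] {β α : ℝ} (hα : 0 < α) {B : ℝ≥0 → Ω → ℝ} (hB : IsGGBm β α B P) :
    HasScalingIncrements B (α / 2) (P.map (B 1)) P := by
  intro s t hst
  have hd : (0 : ℝ) ≤ t - s := sub_nonneg.2 (by exact_mod_cast hst)
  have hBm := hB.measurable
  refine Measure.ext_of_charFun (funext fun θ => ?_)
  rw [hB.charFun_sub hα.ne' hst, charFun_map_mul, hB.charFun_eval hα.ne']
  congr 2
  rw [mul_pow, ← Real.rpow_natCast (((t : ℝ) - s) ^ (α / 2)), ← Real.rpow_mul hd]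
  norm_num
  ring

theorem HasScalingIncrements.congr {Ω : Type*} [MeasurableSpace Ω] {P : Measure Ω}
    {Y Y' : ℝ≥0 → Ω → ℝ} {H : ℝ} {ν : Measure ℝ} (hY : HasScalingIncrements Y H ν P)
    (h : ∀ᵐ ω ∂P, ∀ t, Y' t ω = Y t ω) : HasScalingIncrements Y' H ν P := fun s t hst => by
  rw [← hY s t hst]
  refine Measure.map_congr (h.mono fun ω hω => ?_)
  simp only [hω]

/-- The inverse is measurable for the σ-algebra generated by S: the measurability lemma is reused
with that σ-algebra on Ω. -/
theorem indepFun_inverseProcess {Ω E : Type*} [MeasurableSpace Ω] [MeasurableSpace E]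
    {P : Measure Ω} {X : Ω → E} {S : ℝ≥0 → Ω → ℝ} (hreg : ∀ ω, IsRegularPath fun t => S t ω)
    (h : IndepFun X (fun ω t => S t ω) P) (t : ℝ≥0) : IndepFun X (inverseProcess S t) P := by
  rw [IndepFun_iff_Indep] at h ⊢
  refine indep_of_indep_of_le_right h (Measurable.comap_le ?_)
  have hS : ∀ s, Measurable[MeasurableSpace.comap (fun ω t => S t ω) inferInstance] (S s) :=
    fun s => (measurable_pi_apply s).comp (comap_measurable fun ω t => S t ω)
  exact @measurable_inverseProcess_apply Ω S
    (MeasurableSpace.comap (fun ω t => S t ω) inferInstance)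
    hS hreg t

/-! ### The main theorem -/

theorem mainTheorem1 {Ω Ω' : Type*} [MeasurableSpace Ω] [MeasurableSpace Ω']
    (P : Measure Ω) [IsProbabilityMeasure P] (Q : Measure Ω') [IsProbabilityMeasure Q]
    (β α : ℝ) (hβ₀ : 0 < β) (hβ₁ : β < 1) (hα₁ : 1 < α) (hα₂ : α < 2)
    (B : ℝ≥0 → Ω → ℝ) (hB : IsGGBm β α B P)
    (W S : ℝ≥0 → Ω' → ℝ) (hW : IsBrownianReal W Q) (hS : IsStableSubordinator β S Q)
    (hWS : IndepFun (fun ω t => W t ω) (fun ω t => S t ω) Q) :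
    pathLaw B P ⟂ₘ pathLaw (timeChanged β α W S) Q ∧
    (∀ t : ℝ≥0, P.map (B t) = Q.map (timeChanged β α W S t)) ∧
    (MeasurableSet (indexEvent (2 / α)) ∧ pathLaw B P (indexEvent (2 / α)) = 1) ∧
    (MeasurableSet (indexEvent 2) ∧ pathLaw (timeChanged β α W S) Q (indexEvent 2) = 1) := by
  have hα₀ : 0 < α := one_pos.trans hα₁
  obtain ⟨W', hW'm, hW'c, hW'0, hWW'⟩ := exists_continuous_modification
    hW.toIsPreBrownianReal.aemeasurable hW.cont hW.toIsPreBrownianReal.eval_zero_ae_eq_zero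
  obtain ⟨S', hS'm, hS'r, hSS'⟩ := hS.exists_regular hβ₀
  obtain ⟨B', hB'm, hB'c, hB'0, hBB'⟩ := exists_continuous_modification
    (fun t => (hB.measurable t).aemeasurable) hB.continuous_paths hB.zero
  have hS'L : ∀ (t : ℝ≥0) (θ : ℝ), 0 < θ →
      ∫ ω, Real.exp (-θ * S' t ω) ∂Q = Real.exp (-(t : ℝ) * θ ^ β) := fun t θ hθ => by
    rw [← hS.laplace t θ hθ]
    exact integral_congr_ae (hSS'.mono fun ω h => by simp only [h])
  have hind : ∀ t, IndepFun (fun ω t => W' t ω) (inverseProcess S' t) Q :=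
    indepFun_inverseProcess hS'r (hWS.congr (hWW'.mono fun ω h => funext fun t => (h t).symm)
      (hSS'.mono fun ω h => funext fun t => (h t).symm))
  have hU : ∀ t, Measurable (inverseProcess S' t) := measurable_inverseProcess_apply hS'm hS'r
  have hW'g : ∀ t, Q.map (W' t) = gaussianReal 0 t := fun t => by
    rw [← (hW.toIsPreBrownianReal.hasLaw_eval t).map_eq]
    exact Measure.map_congr (hWW'.mono fun ω h => h t)
  set X := timeChanged β α W S with hX
  set X' := timeChanged β α W' S' with hX'
  have hXX' : ∀ᵐ ω ∂Q, ∀ t, X' t ω = X t ω := by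
    filter_upwards [hWW', hSS'] with ω h1 h2 t
    simp only [hX, hX', timeChanged, inverseProcess, h1, h2]
  have hφm : ∀ ω, Monotone fun t : ℝ≥0 => inverseProcess S' (t ^ (α / β)) ω := fun ω =>
    (monotone_inverseProcess (hS'r ω)).comp (NNReal.monotone_rpow_of_nonneg (by positivity))
  have hφc : ∀ ω, Continuous fun t : ℝ≥0 => inverseProcess S' (t ^ (α / β)) ω := fun ω =>
    (continuous_inverseProcess (hS'r ω)).comp (NNReal.continuous_rpow_const (by positivity))
  have hφ0 : ∀ ω, inverseProcess S' ((0 : ℝ≥0) ^ (α / β)) ω = 0 := fun ω => by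
    rw [NNReal.zero_rpow (by positivity), inverseProcess_zero (hS'r ω)]
  have hX'm : ∀ t, Measurable (X' t) := fun t =>
    (measurable_uncurry_of_continuous_of_measurable hW'c hW'm).comp ((hU _).prodMk measurable_id)
  have hX'c : ∀ ω, Continuous fun t => X' t ω := fun ω => (hW'c ω).comp (hφc ω)
  have hX'0 : ∀ ω, X' 0 ω = 0 := fun ω => by
    simp only [hX', timeChanged, hφ0, hW'0]
  have hlaw : ∀ t : ℝ≥0, P.map (B t) = Q.map (X t) := fun t => by
    have hBt := hB.measurable t
    have e : Q.map (X t) = Q.map (X' t) :=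
      Measure.map_congr (hXX'.mono fun ω h => (h t).symm)
    rw [e]
    have := Measure.isProbabilityMeasure_map (μ := P) hBt.aemeasurable
    have := Measure.isProbabilityMeasure_map (μ := Q) (hX'm t).aemeasurable
    refine Measure.ext_of_charFun (funext fun θ => ?_)
    rw [hB.charFun_eval hα₀.ne']
    have h := charFun_map_eval hW'm hW'c hW'g (hU (t ^ (α / β))) (hind _) θ
    rw [integral_exp_mul_inverseProcess hβ₀ hS'm hS'r hS'L, NNReal.coe_rpow,
      ← Real.rpow_mul t.coe_nonneg, div_mul_cancel₀ _ hβ₀.ne'] at h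
    refine Eq.trans ?_ h.symm
    push_cast
    rfl
  have hν : P.map (B 1) = Q.map fun ω => W' (inverseProcess S' 1 ω) ω := by
    rw [hlaw 1]
    refine Measure.map_congr (hXX'.mono fun ω h => ?_)
    rw [← h]
    simp only [hX', timeChanged, NNReal.one_rpow]
  have hνmom : ∀ m : ℕ, ∫⁻ x, ENNReal.ofReal (x ^ (2 * m)) ∂(P.map (B 1)) ≠ ∞ := fun m => by
    rw [hν, lintegral_map_eval hW'm hW'c hW'g (hU 1) (hind 1) (by fun_prop)]
    rw [lintegral_congr fun ω => lintegral_even_pow_gaussianReal (inverseProcess S' 1 ω) m,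
      lintegral_mul_const _ (by have := hU 1; fun_prop),
      lintegral_inverseProcess_pow hβ₀ hS'm hS'r hS'L]
    exact ENNReal.mul_ne_top ENNReal.ofReal_ne_top (lintegral_even_pow_gaussianReal_ne_top m)
  have hν0 : P.map (B 1) {0} = 0 := by
    have hm : MeasurableSet ({0} : Set ℝ) := measurableSet_singleton 0
    rw [hν, ← lintegral_indicator_one hm, lintegral_map_eval hW'm hW'c hW'g (hU 1) (hind 1)
      (measurable_one.indicator hm)]
    refine (lintegral_congr fun ω => ?_).trans lintegral_zero
    rw [lintegral_indicator_one hm]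
    have := nullSingletonClass_gaussianReal (μ := 0) (inverseProcess_pos (hS'r ω) one_pos).ne'
    exact measure_singleton 0
  have hBs : HasScalingIncrements B' (α / 2) (P.map (B 1)) P :=
    (hB.hasScalingIncrements hα₀).congr hBB'
  have hWs : HasScalingIncrements W' (1 / 2) (gaussianReal 0 1) Q :=
    (hasScalingIncrements_of_isPreBrownianReal hW.toIsPreBrownianReal).congr hWW'
  have hone : ∀ t : unitInterval, unitInterval.toNNReal t ≤ 1 := fun t => by
    rw [← NNReal.coe_le_coe]; exact t.2.2
  have := Measure.isProbabilityMeasure_map (μ := P) (hB.measurable 1).aemeasurable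
  have hB1 : pathLaw B P (indexEvent (2 / α)) = 1 := by
    refine pathLaw_indexEvent_eq_one (by positivity) hB'm hB'c hB'0 hBB' (fun p hp => ?_)
      fun p hp hpα => ?_
    · have hp0 : (0 : ℝ) < p := lt_trans (by positivity) hp
      have hγ : 1 / (p : ℝ) < α / 2 := by
        rw [div_lt_iff₀ hα₀] at hp
        rw [div_lt_div_iff₀ hp0 two_pos]; linarith
      filter_upwards [hBs.ae_holder hB'm hB'c hνmom (by positivity) hγ] with ω hω
      obtain ⟨C, hC⟩ := hω 1
      refine pVariation_lt_top_of_le_rpow hp0 (g := fun t => (t : ℝ)) (C := C)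
        (fun _ _ h => h) fun s t hst => ?_
      exact hC _ _ hst (by simpa using hone t)
    · have hp0 : (0 : ℝ) < p := by exact_mod_cast hp
      refine hBs.ae_seqVariation_eq_top hB'm hB'c hν0 hp0 ?_ one_pos
      rw [lt_div_iff₀ hα₀] at hpα
      rw [div_lt_div_iff₀ two_pos hp0]; linarith
  have hX1 : pathLaw X Q (indexEvent 2) = 1 := by
    refine pathLaw_indexEvent_eq_one two_pos hX'm hX'c hX'0 hXX' (fun p hp => ?_)
      fun p hp hp2 => ?_
    · have hp0 : (0 : ℝ) < p := two_pos.trans hp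
      have hγ : 1 / (p : ℝ) < 1 / 2 := one_div_lt_one_div_of_lt two_pos hp
      filter_upwards [hWs.ae_holder hW'm hW'c lintegral_even_pow_gaussianReal_ne_top
        (by positivity) hγ] with ω hω
      -- The terminal clock value is random, so the Hölder bound for W is needed on all intervals
      -- [0, N] at once.
      obtain ⟨N, hN⟩ := exists_nat_ge (inverseProcess S' ((1 : ℝ≥0) ^ (α / β)) ω)
      obtain ⟨C, hC⟩ := hω N
      refine pVariation_lt_top_of_le_rpow hp0 (C := C) (g := fun t : unitInterval =>
        (inverseProcess S' (unitInterval.toNNReal t ^ (α / β)) ω : ℝ))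
        (fun _ _ h => NNReal.coe_le_coe.2 (hφm ω h)) fun s t hst => ?_
      exact hC _ _ (hφm ω hst) ((hφm ω (hone t)).trans hN)
    · have hp0 : (0 : ℝ) < p := by exact_mod_cast hp
      -- Infinite variation on every [0, 1/(N+1)] simultaneously; one of these lies below the
      -- positive random clock value.
      have hall : ∀ᵐ ω ∂Q, ∀ N : ℕ,
          seqVariation p (fun t => W' t ω) (1 / (N + 1 : ℝ≥0)) = ∞ :=
        ae_all_iff.2 fun N => hWs.ae_seqVariation_eq_top hW'm hW'c
          (by have := nullSingletonClass_gaussianReal (μ := 0) one_ne_zero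
              exact measure_singleton 0) hp0
          (one_div_lt_one_div_of_lt hp0 hp2) (by positivity)
      filter_upwards [hall] with ω hω
      have hpos : 0 < inverseProcess S' ((1 : ℝ≥0) ^ (α / β)) ω :=
        inverseProcess_pos (hS'r ω) (by simp)
      obtain ⟨N, hN⟩ := exists_nat_one_div_lt (K := ℝ≥0) hpos
      exact top_le_iff.1 ((hω N).symm.le.trans
        (seqVariation_le_comp p (fun t => W' t ω) (hφm ω) (hφc ω) (hφ0 ω) hN.le))
  refine ⟨⟨(indexEvent (2 / α))ᶜ, (measurableSet_indexEvent _).compl, ?_, ?_⟩, hlaw,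
    ⟨measurableSet_indexEvent _, hB1⟩, measurableSet_indexEvent _, hX1⟩
  · have hpm : IsProbabilityMeasure (pathLaw B P) := by
      rw [pathLaw, Measure.map_congr (hBB'.mono fun ω h => (toPath_congr h).symm)]
      exact Measure.isProbabilityMeasure_map (measurable_toPath hB'm hB'c hB'0).aemeasurable
    exact (prob_compl_eq_zero_iff (measurableSet_indexEvent _)).2 hB1
  · have hpm : IsProbabilityMeasure (pathLaw X Q) := by
      rw [pathLaw, Measure.map_congr (hXX'.mono fun ω h => (toPath_congr h).symm)]
      exact Measure.isProbabilityMeasure_map (measurable_toPath hX'm hX'c hX'0).aemeasurable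
    have hdisj : Disjoint (indexEvent (2 / α)) (indexEvent 2) :=
      disjoint_indexEvent (by positivity) (by rw [div_lt_iff₀ hα₀]; linarith)
    rw [compl_compl]
    exact measure_mono_null hdisj.subset_compl_right
      ((prob_compl_eq_zero_iff (measurableSet_indexEvent _)).2 hX1)

end
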